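/- **Notation.** For $x\in\mathbb R^d$ let $\lfloor x\rceil\in\mathbb Z^d$ be the unique integer vector with $x-\lfloor x\rceil\in[-1/2,1/2)^d$, and identify $\mathbb T^d=\mathbb R^d/\mathbb Z^d$ with $[-1/2,1/2)^d$. Let $S_t=\{x\in\mathbb R^d:|x|=t\}$ be the Euclidean sphere of radius $t$, let $\sigma$ be the canonical (unnormalized) surface measure on the unit sphere $S^{d-1}=S_1$, and $\mathcal F\sigma(\eta)=\int_{S^{d-1}}e^{-2\pi i\,\eta\cdot x}\,d\sigma(x)$. For integers $1\le p\le q$ with $(p,q)=1$ and $x\in\mathbb Z^d$ let $$G(p/q;x)=q^{-d}\sum_{n\in\{1,\dots,q\}^d}e^{2\pi i(|n|^2p/q+x\cdot n/q)}.$$ For $t>0$ with $\lambda=t^2\in\mathbb N$, $S_t\cap\mathbb Z^d\ne\emptyset$, and $\xi\in\mathbb T^d$, put $$\mathfrak a_{t,p/q}(\xi)=\frac{\lambda^{d/2-1}}{2\,|S_t\cap\mathbb Z^d|}\,e^{-2\pi i\lambda p/q}\,G(p/q;\lfloor q\xi\rceil)\,\mathcal F\sigma\Big(\sqrt\lambda\,\big(\lfloor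 q\xi\rceil/q-\xi\big)\Big).$$ For $f\in\ell^2(\mathbb Z^d)$ let $\hat f(\xi)=\sum_{x\in\mathbb Z^d}f(x)e^{-2\pi i\,x\cdot\xi}$ (convergence in $L^2(\mathbb T^d)$), and for $g\in L^2(\mathbb T^d)$ let $\mathcal F^{-1}g(x)=\int_{\mathbb T^d}g(\xi)e^{2\pi i\,x\cdot\xi}\,d\xi$, $x\in\mathbb Z^d$. For $C>0$ let $\mathbb D_{C,\infty}=\{2^n:n\in\mathbb Z,\ n\ge0,\ 2^n\ge Cd^{3/2}\}$. **Theorem 5.2.** There exist universal constants $C>0$ and $A>0$ such that for all integers $d\ge16$, all integers $1\le p\le q$ with $(p,q)=1$, and all $f\in\ell^2(\mathbb Z^d)$, $$\Big\|\sup_{t\in\mathbb D_{C,\infty}}\big|\mathcal F^{-1}(\mathfrak a_{t,p/q}\,\hat f)\big|\Big\|_{\ell^2(\mathbb Z^d)}\le A\,\|f\|_{\ell^2(\mathbb Z^d)}.$$ In particular $A$ does not depend on $p$, $q$ or $d$. -/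

import Mathlib

open MeasureTheory
open scoped ENNReal

noncomputable section

namespace SphericalMaximal

/-- The vector `⌊x⌉ ∈ ℤ^d`: coordinatewise, the unique integer vector with
`x - ⌊x⌉ ∈ [-1/2, 1/2)^d`. -/
def nearestInt {d : ℕ} (x : EuclideanSpace ℝ (Fin d)) : Fin d → ℤ :=
  fun j => ⌊x j + 1 / 2⌋

theorem nearestInt_eq_iff {d : ℕ} (x : EuclideanSpace ℝ (Fin d)) (m : Fin d → ℤ) :
    nearestInt x = m ↔ ∀ j, x j - m j ∈ Set.Ico (-(1 / 2) : ℝ) (1 / 2) := by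
  simp only [nearestInt, funext_iff, Int.floor_eq_iff, Set.mem_Ico]
  refine forall_congr' fun j => ?_
  constructor <;> rintro ⟨h₁, h₂⟩ <;> constructor <;> linarith

/-- An integer vector, regarded as an element of `ℝ^d`. -/
def toReal {d : ℕ} (x : Fin d → ℤ) : EuclideanSpace ℝ (Fin d) :=
  WithLp.toLp 2 fun j => (x j : ℝ)

/-- The number `|S_t ∩ ℤ^d|` of lattice points on the sphere of radius `t` centred at `0`. -/
def latticeSphereCard (d : ℕ) (t : ℝ) : ℕ :=
  {x : Fin d → ℤ | toReal x ∈ Metric.sphere (0 : EuclideanSpace ℝ (Fin d)) t}.ncard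

/-- The `d`-dimensional normalized Gaussian sum
`G(p/q; x) = q^{-d} ∑_{n ∈ {1, …, q}^d} e^{2πi (|n|² p/q + x·n/q)}`. -/
def gaussSum {d : ℕ} (p q : ℕ) (x : Fin d → ℤ) : ℂ :=
  ((q : ℂ) ^ d)⁻¹ * ∑ n ∈ Fintype.piFinset fun _ : Fin d => Finset.Icc 1 q,
    Complex.exp (2 * Real.pi * Complex.I *
      ((∑ j, (n j : ℂ) ^ 2) * (p / q) + (∑ j, (x j : ℂ) * n j) / q))

/-- The Fourier transform `ℱσ(η) = ∫_{S^{d-1}} e^{-2πi η·x} dσ(x)` of the (unnormalized) canonical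
surface measure `σ` on the unit sphere of `ℝ^d`. Mathlib's `Measure.toSphere` applied to Lebesgue
measure is this surface measure: it is the angular factor of Lebesgue measure in polar coordinates,
with total mass `d * vol(unit ball)`. -/
def sphereFourier {d : ℕ} (η : EuclideanSpace ℝ (Fin d)) : ℂ :=
  ∫ x : Metric.sphere (0 : EuclideanSpace ℝ (Fin d)) 1,
    Complex.exp (-(2 * Real.pi * Complex.I * (inner ℝ η (x : EuclideanSpace ℝ (Fin d)) : ℝ)))
    ∂(volume : Measure (EuclideanSpace ℝ (Fin d))).toSphere

/-- The multiplier `𝔞_{t,p/q}` as a function on `ℝ^d`; here `λ = t²`. -/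
def aMultiplier {d : ℕ} (t : ℝ) (p q : ℕ) (ξ : EuclideanSpace ℝ (Fin d)) : ℂ :=
  (((t ^ 2) ^ ((d : ℝ) / 2 - 1) / (2 * (latticeSphereCard d t : ℝ)) : ℝ) : ℂ) *
    Complex.exp (-(2 * Real.pi * Complex.I * ((t : ℂ) ^ 2 * (p / q)))) *
    gaussSum p q (nearestInt ((q : ℝ) • ξ)) *
    sphereFourier (Real.sqrt (t ^ 2) •
      ((q : ℝ)⁻¹ • toReal (nearestInt ((q : ℝ) • ξ)) - ξ))

/-- The representative in the cube `[-1/2, 1/2)^d` of a point of the torus `ℝ^d / ℤ^d`. -/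
def cubeRep {d : ℕ} (ξ : UnitAddTorus (Fin d)) : EuclideanSpace ℝ (Fin d) :=
  WithLp.toLp 2 fun j => (AddCircle.equivIco (1 : ℝ) (-1 / 2) (ξ j) : ℝ)

/-- Lebesgue measure on the torus `ℝ^d / ℤ^d`, of total mass one. -/
abbrev torusMeasure (d : ℕ) : Measure (UnitAddTorus (Fin d)) :=
  Measure.pi fun _ => AddCircle.haarAddCircle

/-- The character `ξ ↦ e^{-2πi x·ξ}` of the torus, as an element of `L²`. -/
def characterL2 {d : ℕ} (x : Fin d → ℤ) : Lp ℂ 2 (torusMeasure d) :=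
  ContinuousMap.toLp (E := ℂ) 2 (torusMeasure d) ℂ (UnitAddTorus.mFourier (-x))

/-- The Fourier transform `\hat f(ξ) = ∑_{x ∈ ℤ^d} f(x) e^{-2πi x·ξ}` of `f ∈ ℓ²(ℤ^d)`, the series
being convergent in `L²` of the torus. -/
def fourierL2 {d : ℕ} (f : lp (fun _ : Fin d → ℤ => ℂ) 2) : Lp ℂ 2 (torusMeasure d) :=
  ∑' x : Fin d → ℤ, f x • characterL2 x

/-- The series that defines `fourierL2` always converges unconditionally in `L²`. -/
theorem hasSum_fourierL2 {d : ℕ} (f : lp (fun _ : Fin d → ℤ => ℂ) 2) :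
    HasSum (fun x : Fin d → ℤ => f x • characterL2 x) (fourierL2 f) := by
  have hg : Memℓp (fun x : Fin d → ℤ => f (-x)) 2 := by
    have h2 : (0 : ℝ) < (2 : ℝ≥0∞).toReal := by norm_num
    have h := (memℓp_gen_iff h2).1 (lp.memℓp f)
    exact (memℓp_gen_iff h2).2 ((Equiv.neg (Fin d → ℤ)).summable_iff.2 h)
  have h := (UnitAddTorus.mFourierBasis (d := Fin d)).hasSum_repr_symm ⟨_, hg⟩
  have h' := (Equiv.neg (Fin d → ℤ)).hasSum_iff.2 h
  have e : ((fun i : Fin d → ℤ => f (-i) • (UnitAddTorus.mFourierBasis (d := Fin d)) i) ∘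
      Equiv.neg (Fin d → ℤ)) = fun x => f x • characterL2 x := by
    funext x
    simp only [Function.comp_apply, Equiv.neg_apply, neg_neg, UnitAddTorus.coe_mFourierBasis]
    rfl
  have h'' : HasSum (fun x : Fin d → ℤ => f x • characterL2 x) _ := e ▸ h'
  exact h''.summable.hasSum

/-- `ℱ^{-1}(m \hat f)(x) = ∫ m(ξ) \hat f(ξ) e^{2πi x·ξ} dξ`, the integral being over the torus and
the multiplier `m` being read on the cube `[-1/2, 1/2)^d`. -/
def multiplierOp {d : ℕ} (m : EuclideanSpace ℝ (Fin d) → ℂ)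
    (f : lp (fun _ : Fin d → ℤ => ℂ) 2) (x : Fin d → ℤ) : ℂ :=
  ∫ ξ, m (cubeRep ξ) * fourierL2 f ξ * UnitAddTorus.mFourier x ξ ∂torusMeasure d

/-- The set of dyadic numbers `t = 2^n`, `n ≥ 0`, with `t ≥ C d^{3/2}`. -/
def largeDyadic (d : ℕ) (C : ℝ) : Set ℝ :=
  {t | (∃ n : ℕ, t = 2 ^ n) ∧ C * (d : ℝ) ^ (3 / 2 : ℝ) ≤ t}

/-- The `[0, ∞]`-valued maximal function `sup_{t} |ℱ^{-1}(𝔞_{t,p/q} \hat f)(x)|`, with the supremum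
over the dyadic `t ≥ C d^{3/2}`. -/
def maximalFn {d : ℕ} (C : ℝ) (p q : ℕ) (f : lp (fun _ : Fin d → ℤ => ℂ) 2)
    (x : Fin d → ℤ) : ℝ≥0∞ :=
  ⨆ t ∈ largeDyadic d C, ‖multiplierOp (aMultiplier t p q) f x‖ₑ

end SphericalMaximal

end

/-!
# A dimension-free maximal inequality for spherical multipliers along large dyadic radii

Put `m(η) = ℱσ(η) / σ(S^{d-1})`. The multiplier of radius `t` is the product of a normalizing constant
`t^{d-2} σ(S^{d-1}) / (2 |S_t ∩ ℤ^d|)`, a phase, the Gauss sum `G(p/q; ⌊qξ⌉)` and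
`m((t/q) (⌊qξ⌉ - qξ))`. The phase does not depend on `ξ`. The Gauss sum does not depend on `t` and has
modulus at most one, so that by Plancherel's theorem it can be absorbed into `f`. Two facts remain.

*The normalizing constant is bounded* (`sphere_area_le_latticeSphereCard`). All but four coordinates
of a lattice point of `S_t` are chosen in a ball of radius a little less than `t`, with an odd sum of
squares; the rest of `t²` is then an odd number of size at least `t² / d`, and an odd number `m` has
at least a constant multiple of `m` representations as a sum of four squares
(`FourSquares.le_repCount_four`). The latter is proved with left ideals of the integral quaternions:
modulo `m` these are the `2 × 2` matrices, each of the vectors `(1, t)` is killed by some quaternion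
of norm `m` (pigeonhole principle), and different `t` give different quaternions. Unit cubes turn the
count of the first `d - 4` coordinates into a volume, without loss because `t ≥ 2 d^{3/2}`.

*The maximal function with multipliers `m((t/q) (⌊qξ⌉ - qξ))` is bounded on `ℓ²`.* Each of these
multipliers is compared with that of the average of the first `⌈(t/q)²⌉` powers of the Markov operator
of the random walk on `ℤ^d` with steps `± q e_j`. The maximal function of these averages has norm at
most two on `ℓ²`, by Hopf's maximal ergodic lemma (`RandomWalk.lintegral_sq_iSup_average_le`). For the
differences a square function suffices. If `w = ⌊qξ⌉ - qξ` and the walk has the multiplier `1 - 2u`,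
then `u` is comparable with `|w|² / d`, and the bounds `|m(η) - 1| ≲ |η|² / d` and `|m(η)| ≲ √d / |η|`,
with universal constants, show that the difference of the multipliers at the scale `s = t/q` has its
square bounded by a multiple of `min (s² u) (s² u)⁻¹`, which is summable over dyadic `s`
(`tsum_multiplierDiff_le`). Both bounds of `m` come from the identity
`(d - 1) ∫ x_i g(x_i) dσ = ∫ (1 - x_i²) g'(x_i) dσ`, which is the invariance of `σ` under infinitesimal
rotations (`integral_coord_smul_eq`).
-/

set_option linter.unusedSimpArgs false

/-! ### Sums of four squares -/

namespace FourSquares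

open scoped Quaternion

variable {m : ℕ} {a b t t' : ZMod m} {X Y V : ℍ[ℤ]}

/-- When `a² + b² = -1` in `ℤ/m`, the assignment `i ↦ !![a, b; b, -a]`, `j ↦ !![0, 1; -1, 0]` defines
a representation of the integral quaternions by `2 × 2` matrices over `ℤ/m`. The predicate says that
the matrix of `X` kills the column vector `(1, t)`; the quaternions with this property form a left
ideal. -/
def Kills (a b t : ZMod m) (X : ℍ[ℤ]) : Prop :=
  (X.re + X.imI * a - X.imK * b) + t * (X.imI * b + X.imJ + X.imK * a) = 0 ∧
  (X.imI * b - X.imJ + X.imK * a) + t * (X.re - X.imI * a + X.imK * b) = 0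

theorem Kills.normSq_eq_zero (hab : a ^ 2 + b ^ 2 = -1) (h : Kills a b t X) :
    ((Quaternion.normSq X : ℤ) : ZMod m) = 0 := by
  obtain ⟨h₁, h₂⟩ := h
  rw [Quaternion.normSq_def']
  push_cast
  linear_combination ((X.re : ZMod m) - X.imI * a + X.imK * b) * h₁ -
    ((X.imI : ZMod m) * b + X.imJ + X.imK * a) * h₂ + ((X.imI : ZMod m) ^ 2 + X.imK ^ 2) * hab

theorem Kills.mul_left (hab : a ^ 2 + b ^ 2 = -1) (h : Kills a b t X) (Y : ℍ[ℤ]) :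
    Kills a b t (Y * X) := by
  obtain ⟨h₁, h₂⟩ := h
  constructor
  · simp only [Quaternion.re_mul, Quaternion.imI_mul, Quaternion.imJ_mul, Quaternion.imK_mul]
    push_cast
    linear_combination ((Y.re : ZMod m) + Y.imI * a - Y.imK * b) * h₁ +
      ((Y.imI : ZMod m) * b + Y.imJ + Y.imK * a) * h₂ -
      ((Y.imI : ZMod m) * X.imI + Y.imK * X.imK + t * (Y.imI * X.imK - Y.imK * X.imI)) * hab
  · simp only [Quaternion.re_mul, Quaternion.imI_mul, Quaternion.imJ_mul, Quaternion.imK_mul]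
    push_cast
    linear_combination ((Y.imI : ZMod m) * b - Y.imJ + Y.imK * a) * h₁ +
      ((Y.re : ZMod m) - Y.imI * a + Y.imK * b) * h₂ -
      (-((Y.imI : ZMod m) * X.imK - Y.imK * X.imI) +
        t * ((Y.imI : ZMod m) * X.imI + Y.imK * X.imK)) * hab

/-- Two matrices that kill the same nonzero vector have rank at most one and proportional rows, so
that the product of the first with the adjugate of the second vanishes. -/
theorem Kills.exists_mul_star_eq (hm : IsUnit (2 : ZMod m)) (hab : a ^ 2 + b ^ 2 = -1)
    (hV : Kills a b t V) (hX : Kills a b t X) : ∃ Y : ℍ[ℤ], V * star X = Quaternion.coe (m : ℤ) * Y := by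
  obtain ⟨v₁, v₂⟩ := hV
  obtain ⟨x₁, x₂⟩ := hX
  set P := V * star X with hP
  have e₁₁ : (P.re + P.imI * a - P.imK * b : ZMod m) = 0 := by
    rw [hP]
    simp only [Quaternion.re_mul, Quaternion.imI_mul, Quaternion.imJ_mul, Quaternion.imK_mul,
      Quaternion.re_star, Quaternion.imI_star, Quaternion.imJ_star, Quaternion.imK_star]
    push_cast
    linear_combination ((X.re : ZMod m) - X.imI * a + X.imK * b) * v₁ -
      ((V.imI : ZMod m) * b + V.imJ + V.imK * a) * x₂ +
      ((V.imI : ZMod m) * X.imI + V.imK * X.imK) * hab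
  have e₁₂ : (P.imI * b + P.imJ + P.imK * a : ZMod m) = 0 := by
    rw [hP]
    simp only [Quaternion.re_mul, Quaternion.imI_mul, Quaternion.imJ_mul, Quaternion.imK_mul,
      Quaternion.re_star, Quaternion.imI_star, Quaternion.imJ_star, Quaternion.imK_star]
    push_cast
    linear_combination -((X.imI : ZMod m) * b + X.imJ + X.imK * a) * v₁ +
      ((V.imI : ZMod m) * b + V.imJ + V.imK * a) * x₁ +
      ((V.imI : ZMod m) * X.imK - V.imK * X.imI) * hab
  have e₂₁ : (P.imI * b - P.imJ + P.imK * a : ZMod m) = 0 := by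
    rw [hP]
    simp only [Quaternion.re_mul, Quaternion.imI_mul, Quaternion.imJ_mul, Quaternion.imK_mul,
      Quaternion.re_star, Quaternion.imI_star, Quaternion.imJ_star, Quaternion.imK_star]
    push_cast
    linear_combination ((X.re : ZMod m) - X.imI * a + X.imK * b) * v₂ -
      ((V.re : ZMod m) - V.imI * a + V.imK * b) * x₂ -
      ((V.imI : ZMod m) * X.imK - V.imK * X.imI) * hab
  have e₂₂ : (P.re - P.imI * a + P.imK * b : ZMod m) = 0 := by
    rw [hP]
    simp only [Quaternion.re_mul, Quaternion.imI_mul, Quaternion.imJ_mul, Quaternion.imK_mul,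
      Quaternion.re_star, Quaternion.imI_star, Quaternion.imJ_star, Quaternion.imK_star]
    push_cast
    linear_combination -((X.imI : ZMod m) * b + X.imJ + X.imK * a) * v₂ +
      ((V.re : ZMod m) - V.imI * a + V.imK * b) * x₁ +
      ((V.imI : ZMod m) * X.imI + V.imK * X.imK) * hab
  have c₀ : (P.re : ZMod m) = 0 := hm.mul_left_cancel (by linear_combination e₁₁ + e₂₂)
  have c₁ : (P.imI : ZMod m) = 0 := hm.mul_left_cancel (by
    linear_combination 2 * (P.imI : ZMod m) * hab - a * (e₁₁ - e₂₂) - b * (e₁₂ + e₂₁))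
  have c₂ : (P.imJ : ZMod m) = 0 := hm.mul_left_cancel (by linear_combination e₁₂ - e₂₁)
  have c₃ : (P.imK : ZMod m) = 0 := hm.mul_left_cancel (by
    linear_combination 2 * (P.imK : ZMod m) * hab + b * (e₁₁ - e₂₂) - a * (e₁₂ + e₂₁))
  rw [ZMod.intCast_zmod_eq_zero_iff_dvd] at c₀ c₁ c₂ c₃
  obtain ⟨y₀, h₀⟩ := c₀
  obtain ⟨y₁, h₁⟩ := c₁
  obtain ⟨y₂, h₂⟩ := c₂
  obtain ⟨y₃, h₃⟩ := c₃
  obtain ⟨Y, r₀, r₁, r₂, r₃⟩ : ∃ Y : ℍ[ℤ], Y.re = y₀ ∧ Y.imI = y₁ ∧ Y.imJ = y₂ ∧ Y.imK = y₃ :=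
    ⟨⟨y₀, y₁, y₂, y₃⟩, rfl, rfl, rfl, rfl⟩
  refine ⟨Y, ?_⟩
  ext <;> simp only [Quaternion.re_mul, Quaternion.imI_mul, Quaternion.imJ_mul, Quaternion.imK_mul,
    Quaternion.re_coe, Quaternion.imI_coe, Quaternion.imJ_coe, Quaternion.imK_coe, h₀, h₁, h₂, h₃,
    r₀, r₁, r₂, r₃] <;> ring

/-- The parameter `t` can be read off from any element of norm `m` that kills `(1, t)`, because such
an element generates the whole left ideal, and the ideal contains a lift of `!![-t, 1; 0, 0]`. -/
theorem Kills.unique (hm : IsUnit (2 : ZMod m)) (hm0 : m ≠ 0) (hab : a ^ 2 + b ^ 2 = -1)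
    (h : Kills a b t X) (h' : Kills a b t' X) (hX : Quaternion.normSq X = (m : ℤ)) : t = t' := by
  obtain ⟨u, hu⟩ := hm.exists_left_inv
  obtain ⟨v₀, h₀⟩ := ZMod.intCast_surjective (-(t * u))
  obtain ⟨v₁, h₁⟩ := ZMod.intCast_surjective (-(a * (-(t * u)) + b * u))
  obtain ⟨v₂, h₂⟩ := ZMod.intCast_surjective u
  obtain ⟨v₃, h₃⟩ := ZMod.intCast_surjective (-(a * u - b * (-(t * u))))
  set V : ℍ[ℤ] := ⟨v₀, v₁, v₂, v₃⟩ with hV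
  have kV : Kills a b t V := by
    constructor
    · simp only [hV, h₀, h₁, h₂, h₃]
      ring
    · simp only [hV, h₀, h₁, h₂, h₃]
      linear_combination (-u - t ^ 2 * u) * hab
  obtain ⟨Y, hY⟩ := kV.exists_mul_star_eq hm hab h
  have hVY : V = Y * X := by
    have e : Quaternion.coe (m : ℤ) * V = Quaternion.coe (m : ℤ) * (Y * X) := by
      rw [← mul_assoc, ← hY, mul_assoc, Quaternion.star_mul_self, hX, Quaternion.coe_commutes]
    exact mul_left_cancel₀ (fun h0 => hm0 (by exact_mod_cast congrArg QuaternionAlgebra.re h0)) e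
  have kV' : Kills a b t' V := hVY ▸ h'.mul_left hab Y
  obtain ⟨q₁, -⟩ := kV'
  simp only [hV, h₀, h₁, h₂, h₃] at q₁
  linear_combination (t' - t) * hu - q₁ + (t * u - t' * u) * hab

end FourSquares

/-! ### Counting lattice points in balls -/

namespace SphericalMaximal

theorem norm_toReal_sq {k : ℕ} (y : Fin k → ℤ) : ‖toReal y‖ ^ 2 = ((∑ i, y i ^ 2 : ℤ) : ℝ) := by
  simp [EuclideanSpace.norm_sq_eq, toReal]

theorem finite_sum_sq_le (k : ℕ) (n : ℤ) : {x : Fin k → ℤ | ∑ i, x i ^ 2 ≤ n}.Finite := by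
  refine (Set.Finite.pi' (t := fun _ : Fin k => Set.Icc (-n) n) fun _ => Set.finite_Icc _ _).subset ?_
  intro x hx i
  have h : x i ^ 2 ≤ n :=
    (Finset.single_le_sum (f := fun i => x i ^ 2) (fun j _ => sq_nonneg (x j))
      (Finset.mem_univ i)).trans hx
  constructor <;> nlinarith

theorem finite_norm_toReal_le (k : ℕ) (R : ℝ) : {y : Fin k → ℤ | ‖toReal y‖ ≤ R}.Finite := by
  refine (finite_sum_sq_le k ⌊R ^ 2⌋).subset fun y hy => ?_
  have hy' : ‖toReal y‖ ≤ R := hy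
  have h : ‖toReal y‖ ^ 2 ≤ R ^ 2 := by gcongr
  rw [norm_toReal_sq] at h
  exact Int.le_floor.2 h

theorem norm_sub_toReal_nearestInt_le {k : ℕ} (x : EuclideanSpace ℝ (Fin k)) :
    ‖x - toReal (nearestInt x)‖ ≤ √k / 2 := by
  have h := (nearestInt_eq_iff x _).1 rfl
  have h2 : ‖x - toReal (nearestInt x)‖ ^ 2 ≤ (√k / 2) ^ 2 := by
    rw [EuclideanSpace.norm_sq_eq, div_pow, Real.sq_sqrt (Nat.cast_nonneg k)]
    calc _ ≤ ∑ _i : Fin k, (1 / 4 : ℝ) := by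
          refine Finset.sum_le_sum fun i _ => ?_
          obtain ⟨h₁, h₂⟩ := h i
          rw [Real.norm_eq_abs, sq_abs]
          simp only [toReal, PiLp.sub_apply]
          nlinarith
      _ = _ := by simp; ring
  exact le_of_sq_le_sq h2 (by positivity)

theorem volume_nearestInt_eq_le {k : ℕ} (y : Fin k → ℤ) :
    volume {x : EuclideanSpace ℝ (Fin k) | nearestInt x = y} ≤ 1 := by
  have e : {x : EuclideanSpace ℝ (Fin k) | nearestInt x = y} =
      (MeasurableEquiv.toLp 2 (Fin k → ℝ)).symm ⁻¹'
        (Set.univ.pi fun i => Set.Ico ((y i : ℝ) - 1 / 2) (y i + 1 / 2)) := by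
    ext x
    simp only [Set.mem_ofPred_eq, nearestInt_eq_iff, Set.mem_preimage, Set.mem_pi, Set.mem_univ,
      true_imp_iff, Set.mem_Ico]
    refine forall_congr' fun i => ?_
    change _ ↔ _ ≤ x i ∧ x i < _
    constructor <;> rintro ⟨h₁, h₂⟩ <;> constructor <;> linarith
  rw [e, (EuclideanSpace.volume_preserving_symm_measurableEquiv_toLp (Fin k)).measure_preimage_equiv,
    Real.volume_pi_Ico]
  refine le_of_eq (Finset.prod_eq_one fun i _ => ?_)
  norm_num

/-- The unit cubes centred at the lattice points of a ball of radius `R + √k / 2` cover the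
concentric ball of radius `R`. -/
theorem volume_ball_le_ncard (k : ℕ) (R : ℝ) :
    volume (Metric.ball (0 : EuclideanSpace ℝ (Fin k)) R) ≤
      ({y : Fin k → ℤ | ‖toReal y‖ ≤ R + √k / 2}.ncard : ℝ≥0∞) := by
  have hfin := finite_norm_toReal_le k (R + √k / 2)
  calc _ ≤ volume (⋃ y ∈ hfin.toFinset, {x : EuclideanSpace ℝ (Fin k) | nearestInt x = y}) := by
        refine measure_mono fun x hx => ?_
        simp only [Set.Finite.mem_toFinset, Set.mem_ofPred_eq, Set.mem_iUnion, exists_prop,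
          exists_eq_right']
        have h₁ : ‖x‖ < R := by simpa using hx
        have h₂ := norm_sub_toReal_nearestInt_le x
        have h₃ := norm_sub_norm_le (toReal (nearestInt x)) x
        rw [norm_sub_rev] at h₃
        linarith
    _ ≤ ∑ y ∈ hfin.toFinset, volume {x : EuclideanSpace ℝ (Fin k) | nearestInt x = y} :=
        measure_biUnion_finset_le _ _
    _ ≤ ∑ y ∈ hfin.toFinset, 1 := Finset.sum_le_sum fun y _ => volume_nearestInt_eq_le y
    _ = _ := by rw [Set.ncard_eq_toFinset_card _ hfin]; simp

/-- The number of representations of `n` as a sum of `k` squares of integers. -/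
noncomputable def repCount (k : ℕ) (n : ℤ) : ℕ := {x : Fin k → ℤ | ∑ i, x i ^ 2 = n}.ncard

theorem finite_sum_sq_eq (k : ℕ) (n : ℤ) : {x : Fin k → ℤ | ∑ i, x i ^ 2 = n}.Finite :=
  (finite_sum_sq_le k n).subset fun _ hx => le_of_eq hx

end SphericalMaximal

namespace FourSquares

open SphericalMaximal
open scoped Quaternion

/-- A prime `p ≡ -1` modulo `m` with `p ≡ 1` modulo `4` is a sum of two squares. -/
theorem exists_sq_add_sq_eq_neg_one {m : ℕ} (hm : Odd m) : ∃ a b : ZMod m, a ^ 2 + b ^ 2 = -1 := by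
  have hm0 : m ≠ 0 := by rintro rfl; simp at hm
  have hcop : Nat.Coprime m 4 := by
    have : Nat.Coprime m 2 := Nat.coprime_two_right.2 hm
    exact (show 4 = 2 ^ 2 by norm_num) ▸ this.pow_right 2
  have : NeZero (m * 4) := ⟨by positivity⟩
  set φ := ZMod.chineseRemainder hcop
  have hu : IsUnit (φ.symm (-1, 1)) :=
    (Prod.isUnit_iff.2 ⟨isUnit_one.neg, isUnit_one⟩ : IsUnit ((-1, 1) : ZMod m × ZMod 4)).map φ.symm
  obtain ⟨p, -, hp, hpe⟩ := Nat.forall_exists_prime_gt_and_eq_mod hu 0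
  have h : ((p : ZMod m), (p : ZMod 4)) = (-1, 1) := by
    have := congrArg φ hpe
    rw [map_natCast, RingEquiv.apply_symm_apply] at this
    rw [← this]
    rfl
  obtain ⟨h₁, h₂⟩ := Prod.ext_iff.1 h
  have := Fact.mk hp
  have h4 : p % 4 = 1 := by
    have : (p : ZMod 4) = ((1 : ℕ) : ZMod 4) := by simpa using h₂
    exact (ZMod.natCast_eq_natCast_iff' p 1 4).1 this
  obtain ⟨a, b, hab⟩ := Nat.Prime.sq_add_sq (p := p) (by omega)
  refine ⟨a, b, ?_⟩
  have : ((a ^ 2 + b ^ 2 : ℕ) : ZMod m) = p := by rw [hab]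
  push_cast at this
  rw [this]
  exact h₁

/-- The quaternion with a given vector of coordinates. -/
def ofCoords (x : Fin 4 → ℤ) : ℍ[ℤ] := ⟨x 0, x 1, x 2, x 3⟩

theorem normSq_ofCoords (x : Fin 4 → ℤ) : Quaternion.normSq (ofCoords x) = ∑ i, x i ^ 2 := by
  rw [Quaternion.normSq_def', Fin.sum_univ_four]
  rfl

/-- The ball of radius `0.68 √m + 1` in `ℝ⁴` contains more lattice points than there are pairs of
residues modulo `m`. The constant leaves room on both sides: `0.68⁴ π² / 2 > 1` for the count, and
`0.68² < 1 / 2` for the norm of a difference of two such points. -/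
theorem sq_lt_ncard {m : ℕ} (hm : 2500 ≤ m) :
    m ^ 2 < {y : Fin 4 → ℤ | ‖toReal y‖ ≤ 0.68 * √m + 1}.ncard := by
  have h := volume_ball_le_ncard 4 (0.68 * √m)
  have h4 : √((4 : ℕ) : ℝ) / 2 = 1 := by
    rw [show ((4 : ℕ) : ℝ) = 2 ^ 2 by norm_num, Real.sqrt_sq (by norm_num)]; norm_num
  rw [h4, EuclideanSpace.volume_ball, ← ENNReal.ofReal_pow (by positivity),
    ← ENNReal.ofReal_mul (by positivity), ← ENNReal.ofReal_natCast,
    ENNReal.ofReal_le_ofReal_iff (by positivity)] at h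
  have hG : Real.Gamma ((Fintype.card (Fin 4) : ℝ) / 2 + 1) = 2 := by
    rw [show (Fintype.card (Fin 4) : ℝ) / 2 + 1 = (2 : ℕ) + 1 by norm_num, Real.Gamma_nat_eq_factorial]
    norm_num
  rw [hG, Fintype.card_fin] at h
  have e₁ : √(m : ℝ) ^ 4 = (m : ℝ) ^ 2 := by
    rw [show 4 = 2 * 2 by norm_num, pow_mul, Real.sq_sqrt (by positivity)]
  have e₂ : √Real.pi ^ 4 = Real.pi ^ 2 := by
    rw [show 4 = 2 * 2 by norm_num, pow_mul, Real.sq_sqrt (by positivity)]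
  rw [mul_pow, e₁, e₂] at h
  have hpi : (9.8 : ℝ) < Real.pi ^ 2 := by nlinarith [Real.pi_gt_d2]
  have hm2 : (0 : ℝ) < (m : ℝ) ^ 2 := by positivity
  have : ((m ^ 2 : ℕ) : ℝ) < ({y : Fin 4 → ℤ | ‖toReal y‖ ≤ 0.68 * √m + 1}.ncard : ℝ) := by
    push_cast
    nlinarith
  exact_mod_cast this

/-- By the pigeonhole principle two small quaternions agree modulo the left ideal; the norm of their
difference is a multiple of `m`, positive and less than `2 m`. -/
theorem exists_kills {m : ℕ} (hm : 2500 ≤ m) {a b : ZMod m} (hab : a ^ 2 + b ^ 2 = -1)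
    (t : ZMod m) : ∃ x : Fin 4 → ℤ, Kills a b t (ofCoords x) ∧ ∑ i, x i ^ 2 = (m : ℤ) := by
  have : NeZero m := ⟨by omega⟩
  have hfin := finite_norm_toReal_le 4 (0.68 * √m + 1)
  let F : (Fin 4 → ℤ) → ZMod m × ZMod m := fun x =>
    (((x 0 + x 1 * a - x 3 * b) + t * (x 1 * b + x 2 + x 3 * a) : ZMod m),
      ((x 1 * b - x 2 + x 3 * a) + t * (x 0 - x 1 * a + x 3 * b) : ZMod m))
  have hcard : (Finset.univ : Finset (ZMod m × ZMod m)).card < hfin.toFinset.card := by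
    rw [← Set.ncard_eq_toFinset_card _ hfin, Finset.card_univ, Fintype.card_prod, ZMod.card, ← sq]
    exact sq_lt_ncard hm
  obtain ⟨x, hx, y, hy, hxy, hF⟩ := Finset.exists_ne_map_eq_of_card_lt_of_maps_to hcard
    (f := F) fun _ _ => Finset.mem_coe.2 (Finset.mem_univ _)
  have hK : Kills a b t (ofCoords (x - y)) := by
    obtain ⟨h₁, h₂⟩ := Prod.ext_iff.1 hF
    simp only [F] at h₁ h₂
    constructor
    · simp only [ofCoords, Pi.sub_apply]
      push_cast
      linear_combination h₁
    · simp only [ofCoords, Pi.sub_apply]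
      push_cast
      linear_combination h₂
  have hsq : (0.68 * √(m : ℝ) + 1) ^ 2 < m / 2 := by
    have h1 : √(m : ℝ) ^ 2 = m := Real.sq_sqrt (by positivity)
    have h2 : (50 : ℝ) ≤ √m := Real.le_sqrt_of_sq_le (by norm_num; exact_mod_cast hm)
    nlinarith
  have hbound : ∀ z ∈ hfin.toFinset, ((∑ i, z i ^ 2 : ℤ) : ℝ) < m / 2 := by
    intro z hz
    have hz' : ‖toReal z‖ ≤ 0.68 * √m + 1 := by simpa using hz
    rw [← norm_toReal_sq]
    exact lt_of_le_of_lt (by gcongr) hsq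
  have hlt : ∑ i, (x - y) i ^ 2 < 2 * (m : ℤ) := by
    have h₁ : ∑ i, (x - y) i ^ 2 ≤ 2 * ∑ i, x i ^ 2 + 2 * ∑ i, y i ^ 2 := by
      rw [Finset.mul_sum, Finset.mul_sum, ← Finset.sum_add_distrib]
      exact Finset.sum_le_sum fun i _ => by
        simp only [Pi.sub_apply]; nlinarith [sq_nonneg (x i + y i)]
    have h₂ := hbound x hx
    have h₃ := hbound y hy
    have h₄ : ((∑ i, (x - y) i ^ 2 : ℤ) : ℝ) ≤ 2 * ((∑ i, x i ^ 2 : ℤ) : ℝ) +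
        2 * ((∑ i, y i ^ 2 : ℤ) : ℝ) := by exact_mod_cast h₁
    have : ((∑ i, (x - y) i ^ 2 : ℤ) : ℝ) < 2 * (m : ℝ) := by linarith
    exact_mod_cast this
  have hpos : 0 < ∑ i, (x - y) i ^ 2 := by
    obtain ⟨i, hi⟩ := Function.ne_iff.1 (sub_ne_zero.2 hxy)
    exact Finset.sum_pos' (fun j _ => sq_nonneg _) ⟨i, Finset.mem_univ i, by
      have : (x - y) i ≠ 0 := hi
      positivity⟩
  refine ⟨x - y, hK, ?_⟩
  have hd := hK.normSq_eq_zero hab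
  rw [normSq_ofCoords, ZMod.intCast_zmod_eq_zero_iff_dvd] at hd
  obtain ⟨c, hc⟩ := hd
  have hm0 : (0 : ℤ) < m := by exact_mod_cast (by omega : 0 < m)
  rw [hc] at hlt hpos ⊢
  have hc1 : 0 < c := by nlinarith
  have hc2 : c < 2 := by nlinarith
  rw [show c = 1 by omega, mul_one]

/-- A weak form of Jacobi's four-square theorem, for odd numbers. -/
theorem le_repCount_four {m : ℕ} (hm : Odd m) : (m : ℝ) / 2500 ≤ repCount 4 m := by
  rcases lt_or_ge m 2500 with hlt | hge
  · obtain ⟨a, b, c, d, h⟩ := Nat.sum_four_squares m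
    have h1 : 0 < repCount 4 m := by
      rw [repCount, Set.ncard_pos (finite_sum_sq_eq 4 m)]
      refine ⟨![a, b, c, d], ?_⟩
      rw [Set.mem_ofPred_eq, Fin.sum_univ_four]
      change (a : ℤ) ^ 2 + (b : ℤ) ^ 2 + (c : ℤ) ^ 2 + (d : ℤ) ^ 2 = m
      exact_mod_cast h
    have h2 : (1 : ℝ) ≤ repCount 4 m := by exact_mod_cast h1
    have h3 : (m : ℝ) ≤ 2500 := by exact_mod_cast hlt.le
    linarith
  · have : NeZero m := ⟨by omega⟩
    obtain ⟨a, b, hab⟩ := exists_sq_add_sq_eq_neg_one hm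
    have h2 : IsUnit (2 : ZMod m) := by
      exact_mod_cast (ZMod.isUnit_iff_coprime 2 m).2 (Nat.coprime_two_left.2 hm)
    choose x hx hs using exists_kills hge hab
    have hinj : Function.Injective
        fun t => (⟨x t, hs t⟩ : {x : Fin 4 → ℤ | ∑ i, x i ^ 2 = (m : ℤ)}) := by
      intro t t' h
      have he : x t = x t' := congrArg Subtype.val h
      exact (hx t).unique h2 (by omega) hab (he ▸ hx t') (by rw [normSq_ofCoords, hs])
    have := (finite_sum_sq_eq 4 m).to_subtype
    have := Nat.card_le_card_of_injective _ hinj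
    rw [Nat.card_zmod, Nat.card_coe_set_eq] at this
    have h3 : (m : ℝ) ≤ repCount 4 m := by exact_mod_cast this
    linarith [(Nat.cast_nonneg m : (0 : ℝ) ≤ m)]

end FourSquares

/-! ### Lattice points on spheres -/

namespace SphericalMaximal

/-- The completions of different `y` to representations of `n` by `k + 4` squares are different. -/
theorem sum_repCount_four_le (k : ℕ) (n : ℤ) (Y : Finset (Fin k → ℤ)) :
    ∑ y ∈ Y, repCount 4 (n - ∑ i, y i ^ 2) ≤ repCount (k + 4) n := by
  have hfin := fun j : ℤ => finite_sum_sq_eq 4 j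
  have e : ∀ y ∈ Y, repCount 4 (n - ∑ i, y i ^ 2) = (hfin (n - ∑ i, y i ^ 2)).toFinset.card :=
    fun y _ => Set.ncard_eq_toFinset_card _ _
  rw [Finset.sum_congr rfl e, ← Finset.card_sigma, repCount,
    Set.ncard_eq_toFinset_card _ (finite_sum_sq_eq (k + 4) n)]
  refine Finset.card_le_card_of_injOn (fun p => Fin.append p.1 p.2) ?_ ?_
  · rintro ⟨y, z⟩ h
    have h2 : ∑ i, z i ^ 2 = n - ∑ i, y i ^ 2 := by simpa using (Finset.mem_sigma.1 h).2
    simp only [Set.Finite.coe_toFinset, Set.mem_ofPred_eq, Fin.sum_univ_add, Fin.append_left,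
      Fin.append_right, h2]
    ring
  · rintro ⟨y, z⟩ - ⟨y', z'⟩ - h
    have h' : Fin.append y z = Fin.append y' z' := h
    have h₁ : y = y' := funext fun i => by
      simpa using congrFun h' (Fin.castAdd 4 i)
    have h₂ : z = z' := funext fun i => by
      simpa using congrFun h' (Fin.natAdd k i)
    rw [h₁, h₂]

/-- At least half of the lattice points of a ball, up to a unit change of the radius, have odd norm
squared: adding a basis vector changes the parity. -/
theorem ncard_le_two_mul_ncard_odd {k : ℕ} (hk : 0 < k) (R : ℝ) :
    {y : Fin k → ℤ | ‖toReal y‖ ≤ R - 1}.ncard ≤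
      2 * {y : Fin k → ℤ | ‖toReal y‖ ≤ R ∧ Odd (∑ i, y i ^ 2)}.ncard := by
  set B := {y : Fin k → ℤ | ‖toReal y‖ ≤ R - 1}
  set Y := {y : Fin k → ℤ | ‖toReal y‖ ≤ R ∧ Odd (∑ i, y i ^ 2)}
  have hY : Y.Finite := (finite_norm_toReal_le k R).subset fun y hy => hy.1
  let j : Fin k := ⟨0, hk⟩
  let s : (Fin k → ℤ) → (Fin k → ℤ) := fun y => y + Pi.single j 1
  have hs : Function.Injective s := add_left_injective _
  have hsub : B ⊆ Y ∪ s ⁻¹' Y := by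
    intro y hy
    have hy' : ‖toReal y‖ ≤ R - 1 := hy
    rcases Int.even_or_odd (∑ i, y i ^ 2) with h | h
    · right
      refine ⟨?_, ?_⟩
      · have e : toReal (s y) = toReal y + EuclideanSpace.single j (1 : ℝ) := by
          ext i
          simp only [toReal, s, Pi.add_apply, Pi.single_apply, PiLp.add_apply,
            PiLp.single_apply]
          split_ifs <;> simp
        rw [e]
        refine (norm_add_le _ _).trans ?_
        rw [PiLp.norm_single]
        norm_num
        linarith
      · have e : ∑ i, s y i ^ 2 = ∑ i, y i ^ 2 + (2 * y j + 1) := by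
          have h1 : ∀ i, s y i ^ 2 = y i ^ 2 + (if i = j then 2 * y i + 1 else 0) := by
            intro i
            simp only [s, Pi.add_apply, Pi.single_apply]
            split_ifs <;> ring
          rw [Finset.sum_congr rfl fun i _ => h1 i, Finset.sum_add_distrib]
          simp
        rw [e]
        exact h.add_odd (odd_two_mul_add_one _)
    · left
      exact ⟨by linarith, h⟩
  have hY' : (s ⁻¹' Y).Finite := hY.preimage hs.injOn
  calc B.ncard ≤ (Y ∪ s ⁻¹' Y).ncard := Set.ncard_le_ncard hsub (hY.union hY')
    _ ≤ Y.ncard + (s ⁻¹' Y).ncard := Set.ncard_union_le _ _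
    _ ≤ Y.ncard + Y.ncard :=
        Nat.add_le_add_left (Set.ncard_le_ncard_of_injOn s (fun y hy => hy) hs.injOn hY) _
    _ = _ := by ring

theorem latticeSphereCard_two_pow (d n : ℕ) :
    latticeSphereCard d (2 ^ n) = repCount d (4 ^ n) := by
  rw [latticeSphereCard, repCount]
  congr 1
  ext x
  rw [Set.mem_ofPred_eq, Set.mem_ofPred_eq, mem_sphere_zero_iff_norm,
    ← sq_eq_sq₀ (norm_nonneg _) (by positivity), norm_toReal_sq, ← pow_mul, mul_comm n 2, pow_mul,
    show (2 : ℝ) ^ 2 = 4 by norm_num]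
  exact_mod_cast Iff.rfl

/-- The volume of the unit ball of `ℝ^k`. -/
noncomputable def unitBallVolume (k : ℕ) : ℝ := √Real.pi ^ k / Real.Gamma (k / 2 + 1)

theorem unitBallVolume_pos (k : ℕ) : 0 < unitBallVolume k := by
  have := Real.pi_pos
  have := Real.Gamma_pos_of_pos (show (0 : ℝ) < (k : ℝ) / 2 + 1 by positivity)
  unfold unitBallVolume
  positivity

theorem unitBallVolume_add_four (k : ℕ) :
    ((k + 4 : ℕ) : ℝ) * unitBallVolume (k + 4) = 4 * Real.pi ^ 2 / (k + 2) * unitBallVolume k := by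
  have hG := Real.Gamma_pos_of_pos (show (0 : ℝ) < (k : ℝ) / 2 + 1 by positivity)
  have e : Real.Gamma (((k + 4 : ℕ) : ℝ) / 2 + 1) =
      ((k : ℝ) / 2 + 2) * (((k : ℝ) / 2 + 1) * Real.Gamma ((k : ℝ) / 2 + 1)) := by
    rw [← Real.Gamma_add_one (by positivity), show (k : ℝ) / 2 + 1 + 1 = k / 2 + 2 by ring,
      ← Real.Gamma_add_one (by positivity)]
    congr 1
    push_cast
    ring
  have e2 : √Real.pi ^ 4 = Real.pi ^ 2 := by
    rw [show 4 = 2 * 2 by norm_num, pow_mul, Real.sq_sqrt Real.pi_pos.le]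
  rw [unitBallVolume, unitBallVolume, e, pow_add, e2]
  push_cast
  field_simp
  ring

theorem volume_real_ball {k : ℕ} (hk : 0 < k) {R : ℝ} (hR : 0 ≤ R) :
    volume.real (Metric.ball (0 : EuclideanSpace ℝ (Fin k)) R) = R ^ k * unitBallVolume k := by
  have : Nonempty (Fin k) := ⟨⟨0, hk⟩⟩
  rw [measureReal_def, EuclideanSpace.volume_ball, Fintype.card_fin, ENNReal.toReal_mul,
    ENNReal.toReal_pow, ENNReal.toReal_ofReal hR]
  congr 1
  exact ENNReal.toReal_ofReal (unitBallVolume_pos k).le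

theorem exp_neg_four_le {k : ℕ} (hk : 4 ≤ k) : Real.exp (-4) ≤ (1 - 2 / (k : ℝ)) ^ k := by
  have hk0 : (4 : ℝ) ≤ k := by exact_mod_cast hk
  set x : ℝ := 2 / k with hx
  have hx0 : 0 ≤ x := by positivity
  have hx1 : x ≤ 1 / 2 := by rw [hx, div_le_iff₀ (by linarith)]; linarith
  have h1 : Real.exp (-(2 * x)) ≤ 1 - x := by
    rw [Real.exp_neg]
    apply inv_le_of_inv_le₀ (by linarith)
    refine le_trans ?_ (Real.add_one_le_exp _)
    rw [inv_le_iff_one_le_mul₀ (by linarith)]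
    nlinarith
  calc Real.exp (-4) = Real.exp (-(2 * x)) ^ k := by
        rw [← Real.exp_nat_mul]
        congr 1
        rw [hx]
        field_simp
        norm_num
    _ ≤ _ := pow_le_pow_left₀ (Real.exp_pos _).le h1 k

/-- For `t ≥ 2 d^{3/2}` the volume of a ball of radius about `t` changes only by a bounded factor
when the radius changes by `√d`, so that counting lattice points amounts to computing volumes. The
count on the sphere follows by fixing all but four coordinates and representing the rest of `t²` as
a sum of four squares. -/
theorem sphere_area_le_latticeSphereCard {d : ℕ} (hd : 16 ≤ d) (n : ℕ)
    (ht : 2 * (d : ℝ) ^ (3 / 2 : ℝ) ≤ 2 ^ n) :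
    ((2 : ℝ) ^ n) ^ (d - 2) * (d * unitBallVolume d) ≤
      200000 * Real.exp 4 * latticeSphereCard d (2 ^ n) := by
  obtain ⟨k, rfl⟩ : ∃ k, d = k + 4 := ⟨d - 4, by omega⟩
  have hk : 12 ≤ k := by omega
  have hkR : (12 : ℝ) ≤ k := by exact_mod_cast hk
  set t : ℝ := 2 ^ n with htdef
  have ht0 : 0 < t := by positivity
  have hkt : k * (1 + √k / 2) ≤ t := by
    have e : ((k + 4 : ℕ) : ℝ) ^ (3 / 2 : ℝ) = ((k + 4 : ℕ) : ℝ) * √((k + 4 : ℕ) : ℝ) := by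
      rw [Real.sqrt_eq_rpow, ← Real.rpow_one_add' (by positivity) (by norm_num)]
      norm_num
    rw [e] at ht
    have h1 : √(k : ℝ) ≤ √((k + 4 : ℕ) : ℝ) := Real.sqrt_le_sqrt (by push_cast; linarith)
    have h2 : 1 ≤ √(k : ℝ) := Real.one_le_sqrt.2 (by linarith)
    have h3 : (k : ℝ) ≤ ((k + 4 : ℕ) : ℝ) := by push_cast; linarith
    calc (k : ℝ) * (1 + √k / 2) ≤ ((k + 4 : ℕ) : ℝ) * (2 * √((k + 4 : ℕ) : ℝ)) := by
          gcongr; linarith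
      _ ≤ t := by linarith
  have hn : n ≠ 0 := by
    rintro rfl
    have : t = 1 := by simp [htdef]
    have h2 : 0 ≤ √(k : ℝ) := Real.sqrt_nonneg _
    nlinarith
  set R : ℝ := t * (1 - 1 / k) with hR
  set Y := {y : Fin k → ℤ | ‖toReal y‖ ≤ R ∧ Odd (∑ i, y i ^ 2)} with hYdef
  have hY : Y.Finite := (finite_norm_toReal_le k R).subset fun y hy => hy.1
  have hk1 : (1 : ℝ) / k ≤ 1 := by rw [div_le_one (by linarith)]; linarith
  have hR0 : 0 ≤ R := mul_nonneg ht0.le (by linarith)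
  -- each admissible choice of the first `k` coordinates has many completions
  have hfour : ∀ y ∈ hY.toFinset, t ^ 2 / (2500 * k) ≤ (repCount 4 (4 ^ n - ∑ i, y i ^ 2) : ℝ) := by
    intro y hy
    obtain ⟨hyR, hyo⟩ : ‖toReal y‖ ≤ R ∧ Odd (∑ i, y i ^ 2) := by simpa [hYdef] using hy
    have h1 : ((∑ i, y i ^ 2 : ℤ) : ℝ) ≤ R ^ 2 := by
      rw [← norm_toReal_sq]; gcongr
    have h2 : R ^ 2 ≤ t ^ 2 - t ^ 2 / k := by
      have : (1 - 1 / (k : ℝ)) ^ 2 ≤ 1 - 1 / k := by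
        have : (0 : ℝ) ≤ 1 / k := by positivity
        nlinarith
      calc R ^ 2 = t ^ 2 * (1 - 1 / (k : ℝ)) ^ 2 := by rw [hR]; ring
        _ ≤ t ^ 2 * (1 - 1 / k) := by gcongr
        _ = _ := by ring
    have ht4 : t ^ 2 = ((4 ^ n : ℤ) : ℝ) := by
      rw [htdef, ← pow_mul, mul_comm n 2, pow_mul]; norm_num
    have h3 : t ^ 2 / k ≤ ((4 ^ n - ∑ i, y i ^ 2 : ℤ) : ℝ) := by
      rw [Int.cast_sub, ← ht4]; linarith
    have h4 : (0 : ℝ) ≤ ((4 ^ n - ∑ i, y i ^ 2 : ℤ) : ℝ) := le_trans (by positivity) h3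
    obtain ⟨m, hm⟩ := Int.eq_ofNat_of_zero_le (by exact_mod_cast h4 : 0 ≤ 4 ^ n - ∑ i, y i ^ 2)
    have hmo : Odd m := by
      have h5 : Even ((4 : ℤ) ^ n) := (show Even (4 : ℤ) by decide).pow_of_ne_zero hn
      have h6 : Odd ((m : ℕ) : ℤ) := hm ▸ h5.sub_odd hyo
      exact_mod_cast h6
    rw [hm] at h3 ⊢
    refine le_trans ?_ (FourSquares.le_repCount_four hmo)
    calc t ^ 2 / (2500 * k) = t ^ 2 / k / 2500 := by field_simp
      _ ≤ _ := by
        have : t ^ 2 / k ≤ (m : ℝ) := by exact_mod_cast h3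
        gcongr
  have hsum : (Y.ncard : ℝ) * (t ^ 2 / (2500 * k)) ≤ latticeSphereCard (k + 4) t := by
    rw [htdef, latticeSphereCard_two_pow, Set.ncard_eq_toFinset_card _ hY, ← nsmul_eq_mul]
    refine (Finset.card_nsmul_le_sum _ _ _ hfour).trans ?_
    exact_mod_cast sum_repCount_four_le k (4 ^ n) hY.toFinset
  -- the number of admissible choices is at least a multiple of a volume
  have hcount : Real.exp (-4) * t ^ k * unitBallVolume k ≤ 2 * (Y.ncard : ℝ) := by
    have hR' : t * (1 - 2 / k) ≤ R - 1 - √k / 2 := by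
      have : 1 + √k / 2 ≤ t / k := by rw [le_div_iff₀ (by linarith)]; linarith
      rw [hR]
      have e : t * (1 - 2 / k) = t * (1 - 1 / k) - t / k := by ring
      linarith
    have h0 : 0 ≤ t * (1 - 2 / k) := by
      have : (2 : ℝ) / k ≤ 1 := by rw [div_le_one (by linarith)]; linarith
      exact mul_nonneg ht0.le (by linarith)
    have hv := volume_ball_le_ncard k (R - 1 - √k / 2)
    rw [sub_add_cancel] at hv
    have hv2 : volume.real (Metric.ball (0 : EuclideanSpace ℝ (Fin k)) (t * (1 - 2 / k))) ≤
        ({y : Fin k → ℤ | ‖toReal y‖ ≤ R - 1}.ncard : ℝ) := by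
      rw [measureReal_def]
      refine ENNReal.toReal_le_of_le_ofReal (by positivity) ?_
      rw [ENNReal.ofReal_natCast]
      exact (measure_mono (Metric.ball_subset_ball hR')).trans hv
    rw [volume_real_ball (by omega) h0, mul_pow] at hv2
    have h3 := exp_neg_four_le (show 4 ≤ k by omega)
    have h4 : ({y : Fin k → ℤ | ‖toReal y‖ ≤ R - 1}.ncard : ℝ) ≤ 2 * (Y.ncard : ℝ) := by
      exact_mod_cast ncard_le_two_mul_ncard_odd (by omega) R
    have h5 := (unitBallVolume_pos k).le
    calc Real.exp (-4) * t ^ k * unitBallVolume k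
        ≤ (1 - 2 / (k : ℝ)) ^ k * t ^ k * unitBallVolume k := by gcongr
      _ ≤ _ := by linarith
  rw [unitBallVolume_add_four, show k + 4 - 2 = k + 2 by omega]
  have hV := unitBallVolume_pos k
  have hpi : Real.pi ^ 2 ≤ 10 := by nlinarith [Real.pi_lt_d2, Real.pi_pos]
  have hexp : Real.exp 4 * Real.exp (-4) = 1 := by rw [← Real.exp_add]; norm_num
  have hfrac : 4 * Real.pi ^ 2 / ((k : ℝ) + 2) ≤ 40 / k := by
    gcongr <;> linarith
  calc t ^ (k + 2) * (4 * Real.pi ^ 2 / (k + 2) * unitBallVolume k)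
      ≤ t ^ (k + 2) * (40 / k * unitBallVolume k) := by gcongr
    _ = 200000 * (Real.exp 4 * (Real.exp (-4) * t ^ k * unitBallVolume k / 2 *
          (t ^ 2 / (2500 * k)))) := by
        rw [show Real.exp 4 * (Real.exp (-4) * t ^ k * unitBallVolume k / 2 * (t ^ 2 / (2500 * k))) =
          (Real.exp 4 * Real.exp (-4)) * (t ^ k * unitBallVolume k / 2 * (t ^ 2 / (2500 * k))) by ring,
          hexp]
        field_simp
        ring
    _ ≤ 200000 * (Real.exp 4 * (Y.ncard * (t ^ 2 / (2500 * k)))) := by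
        have : Real.exp (-4) * t ^ k * unitBallVolume k / 2 ≤ (Y.ncard : ℝ) := by linarith
        gcongr
    _ ≤ 200000 * (Real.exp 4 * latticeSphereCard (k + 4) t) := by gcongr
    _ = _ := by ring

end SphericalMaximal

/-! ### The Fourier transform of the sphere -/

namespace SphericalMaximal

open scoped Pointwise

variable {d : ℕ}

/-- The unit sphere of `ℝ^d`. -/
abbrev UnitSphere (d : ℕ) := Metric.sphere (0 : EuclideanSpace ℝ (Fin d)) 1

/-- The unnormalized surface measure on the unit sphere. -/
noncomputable abbrev surfaceMeasure (d : ℕ) : Measure (UnitSphere d) :=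
  (volume : Measure (EuclideanSpace ℝ (Fin d))).toSphere

/-- The action of a linear isometry on the unit sphere. -/
noncomputable def sphereMap (L : EuclideanSpace ℝ (Fin d) ≃ₗᵢ[ℝ] EuclideanSpace ℝ (Fin d)) :
    UnitSphere d → UnitSphere d :=
  fun x => ⟨L x, by simp⟩

theorem continuous_sphereMap (L : EuclideanSpace ℝ (Fin d) ≃ₗᵢ[ℝ] EuclideanSpace ℝ (Fin d)) :
    Continuous (sphereMap L) := by
  unfold sphereMap
  fun_prop

theorem map_sphereMap (L : EuclideanSpace ℝ (Fin d) ≃ₗᵢ[ℝ] EuclideanSpace ℝ (Fin d)) :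
    (surfaceMeasure d).map (sphereMap L) = surfaceMeasure d := by
  have hm := (continuous_sphereMap L).measurable
  ext s hs
  rw [Measure.map_apply hm hs, Measure.toSphere_apply' _ hs, Measure.toSphere_apply' _ (hm hs)]
  congr 1
  have e : Set.Ioo (0 : ℝ) 1 • ((↑) '' (sphereMap L ⁻¹' s) : Set (EuclideanSpace ℝ (Fin d))) =
      L ⁻¹' (Set.Ioo (0 : ℝ) 1 • ((↑) '' s : Set (EuclideanSpace ℝ (Fin d)))) := by
    ext y
    simp only [Set.mem_smul, Set.mem_preimage, Set.mem_image]
    constructor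
    · rintro ⟨r, hr, _, ⟨x, hx, rfl⟩, rfl⟩
      exact ⟨r, hr, L x, ⟨sphereMap L x, hx, rfl⟩, by simp⟩
    · rintro ⟨r, hr, _, ⟨x, hx, rfl⟩, h⟩
      refine ⟨r, hr, L.symm x, ⟨sphereMap L.symm x, ?_, rfl⟩, ?_⟩
      · have : sphereMap L (sphereMap L.symm x) = x := Subtype.ext (by simp [sphereMap])
        rw [this]; exact hx
      · apply L.injective
        rw [← h]
        simp
  rw [e]
  exact (L.measurePreserving).measure_preimage_equiv (f := L.toMeasurableEquiv) _

theorem integral_comp_sphereMap {F : Type*} [NormedAddCommGroup F] [NormedSpace ℝ F]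
    (L : EuclideanSpace ℝ (Fin d) ≃ₗᵢ[ℝ] EuclideanSpace ℝ (Fin d)) {f : UnitSphere d → F}
    (hf : Continuous f) :
    ∫ x, f (sphereMap L x) ∂surfaceMeasure d = ∫ x, f x ∂surfaceMeasure d := by
  have h := integral_map (μ := surfaceMeasure d) (continuous_sphereMap L).aemeasurable
    (f := f) (by rw [map_sphereMap]; exact hf.aestronglyMeasurable)
  rw [map_sphereMap] at h
  exact h.symm

theorem sum_coord_sq (x : UnitSphere d) : ∑ i, (x : EuclideanSpace ℝ (Fin d)) i ^ 2 = 1 := by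
  have h : ‖(x : EuclideanSpace ℝ (Fin d))‖ = 1 := by simp
  have h2 := EuclideanSpace.norm_sq_eq (x : EuclideanSpace ℝ (Fin d))
  rw [h] at h2
  simpa using h2.symm

theorem coord_mem_Icc (x : UnitSphere d) (i : Fin d) :
    (x : EuclideanSpace ℝ (Fin d)) i ∈ Set.Icc (-1 : ℝ) 1 := by
  have h : (x : EuclideanSpace ℝ (Fin d)) i ^ 2 ≤ 1 := by
    rw [← sum_coord_sq x]
    exact Finset.single_le_sum (f := fun i => (x : EuclideanSpace ℝ (Fin d)) i ^ 2)
      (fun j _ => sq_nonneg _) (Finset.mem_univ i)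
  exact abs_le.1 ((sq_le_one_iff_abs_le_one _).1 h)

theorem continuous_coord (i : Fin d) :
    Continuous fun x : UnitSphere d => (x : EuclideanSpace ℝ (Fin d)) i := by fun_prop

theorem integrable_of_continuous {F : Type*} [NormedAddCommGroup F]
    {f : UnitSphere d → F} (hf : Continuous f) : Integrable f (surfaceMeasure d) :=
  hf.integrable_of_hasCompactSupport (HasCompactSupport.of_compactSpace f)

theorem continuous_comp_coord {F : Type*} [TopologicalSpace F] {g : ℝ → F}
    (hg : ContinuousOn g (Set.Icc (-1) 1)) (i : Fin d) :
    Continuous fun x : UnitSphere d => g ((x : EuclideanSpace ℝ (Fin d)) i) :=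
  hg.comp_continuous (continuous_coord i) fun x => coord_mem_Icc x i

/-- The reflection in the line spanned by `cos α • e_i + sin α • e_j`. -/
theorem exists_isometry_coords {i j : Fin d} (hij : i ≠ j) (α : ℝ) :
    ∃ L : EuclideanSpace ℝ (Fin d) ≃ₗᵢ[ℝ] EuclideanSpace ℝ (Fin d), ∀ x,
      L x i = Real.cos (2 * α) * x i + Real.sin (2 * α) * x j ∧
      L x j = Real.sin (2 * α) * x i - Real.cos (2 * α) * x j := by
  set v : EuclideanSpace ℝ (Fin d) :=
    Real.cos α • EuclideanSpace.single i 1 + Real.sin α • EuclideanSpace.single j 1 with hv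
  have vi : v i = Real.cos α := by simp [hv, hij]
  have vj : v j = Real.sin α := by simp [hv, hij.symm]
  have hinner : ∀ x, inner ℝ v x = Real.cos α * x i + Real.sin α * x j := by
    intro x
    rw [hv, inner_add_left, inner_smul_left, inner_smul_left, EuclideanSpace.inner_single_left,
      EuclideanSpace.inner_single_left]
    simp
  have hn : ‖v‖ ^ 2 = 1 := by
    rw [← real_inner_self_eq_norm_sq, hinner, vi, vj, ← sq, ← sq, Real.cos_sq_add_sin_sq]
  refine ⟨Submodule.reflection (Submodule.span ℝ {v}), fun x => ?_⟩
  rw [Submodule.reflection_singleton_apply]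
  simp only [RCLike.ofReal_real_eq_id, id, hn, hinner, PiLp.sub_apply, PiLp.smul_apply, vi, vj,
    smul_eq_mul, div_one, two_smul, PiLp.add_apply]
  rw [Real.cos_two_mul, Real.sin_two_mul]
  have := Real.sin_sq_add_cos_sq α
  constructor
  · ring
  · linear_combination 2 * x j * this

/-- The infinitesimal form of the invariance of the surface measure under rotations in the plane of
the coordinates `i` and `j`, applied to the function `x j • g (x i)`. -/
theorem integral_coord_smul {F : Type*} [NormedAddCommGroup F] [NormedSpace ℝ F]
    [CompleteSpace F] {g g' : ℝ → F}
    (hg : ∀ x ∈ Set.Icc (-1 : ℝ) 1, HasDerivAt g (g' x) x)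
    (hg' : ContinuousOn g' (Set.Icc (-1) 1)) {i j : Fin d} (hij : i ≠ j) :
    ∫ x : UnitSphere d, (x : EuclideanSpace ℝ (Fin d)) i • g ((x : EuclideanSpace ℝ (Fin d)) i)
        ∂surfaceMeasure d =
      ∫ x : UnitSphere d, (x : EuclideanSpace ℝ (Fin d)) j ^ 2 •
        g' ((x : EuclideanSpace ℝ (Fin d)) i) ∂surfaceMeasure d := by
  have hgc : ContinuousOn g (Set.Icc (-1) 1) := fun x hx => (hg x hx).continuousAt.continuousWithinAt
  choose L hL using exists_isometry_coords (d := d) hij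
  have hmem : ∀ α (x : UnitSphere d), Real.cos (2 * α) * (x : EuclideanSpace ℝ (Fin d)) i +
      Real.sin (2 * α) * (x : EuclideanSpace ℝ (Fin d)) j ∈ Set.Icc (-1 : ℝ) 1 := fun α x =>
    (hL α x).1 ▸ coord_mem_Icc (sphereMap (L α) x) i
  have hmem' : ∀ α (x : UnitSphere d), Real.sin (2 * α) * (x : EuclideanSpace ℝ (Fin d)) i -
      Real.cos (2 * α) * (x : EuclideanSpace ℝ (Fin d)) j ∈ Set.Icc (-1 : ℝ) 1 := fun α x =>
    (hL α x).2 ▸ coord_mem_Icc (sphereMap (L α) x) j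
  let Φ : ℝ → UnitSphere d → F := fun α x =>
    (Real.sin (2 * α) * (x : EuclideanSpace ℝ (Fin d)) i -
      Real.cos (2 * α) * (x : EuclideanSpace ℝ (Fin d)) j) •
    g (Real.cos (2 * α) * (x : EuclideanSpace ℝ (Fin d)) i +
      Real.sin (2 * α) * (x : EuclideanSpace ℝ (Fin d)) j)
  let Φ' : ℝ → UnitSphere d → F := fun α x =>
    (Real.sin (2 * α) * (x : EuclideanSpace ℝ (Fin d)) i -
      Real.cos (2 * α) * (x : EuclideanSpace ℝ (Fin d)) j) •
    ((-2 * (Real.sin (2 * α) * (x : EuclideanSpace ℝ (Fin d)) i -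
      Real.cos (2 * α) * (x : EuclideanSpace ℝ (Fin d)) j)) •
    g' (Real.cos (2 * α) * (x : EuclideanSpace ℝ (Fin d)) i +
      Real.sin (2 * α) * (x : EuclideanSpace ℝ (Fin d)) j)) +
    (2 * (Real.cos (2 * α) * (x : EuclideanSpace ℝ (Fin d)) i +
      Real.sin (2 * α) * (x : EuclideanSpace ℝ (Fin d)) j)) •
    g (Real.cos (2 * α) * (x : EuclideanSpace ℝ (Fin d)) i +
      Real.sin (2 * α) * (x : EuclideanSpace ℝ (Fin d)) j)
  have hcont : ∀ α, Continuous (Φ α) := fun α =>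
    Continuous.smul (by fun_prop) (hgc.comp_continuous (by fun_prop) (hmem α))
  have hcont' : ∀ α, Continuous (Φ' α) := fun α =>
    (Continuous.smul (by fun_prop) (Continuous.smul (by fun_prop)
      (hg'.comp_continuous (by fun_prop) (hmem α)))).add
      (Continuous.smul (by fun_prop) (hgc.comp_continuous (by fun_prop) (hmem α)))
  have hderiv : ∀ α x, HasDerivAt (fun α => Φ α x) (Φ' α x) α := by
    intro α x
    have h2 : HasDerivAt (fun α : ℝ => 2 * α) 2 α := by simpa using (hasDerivAt_id α).const_mul 2
    have hs := h2.sin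
    have hc := h2.cos
    have hin := (hc.mul_const ((x : EuclideanSpace ℝ (Fin d)) i)).fun_add
      (hs.mul_const ((x : EuclideanSpace ℝ (Fin d)) j))
    have hout := (hs.mul_const ((x : EuclideanSpace ℝ (Fin d)) i)).fun_sub
      (hc.mul_const ((x : EuclideanSpace ℝ (Fin d)) j))
    have hcomp : HasDerivAt (fun α => g (Real.cos (2 * α) * (x : EuclideanSpace ℝ (Fin d)) i +
        Real.sin (2 * α) * (x : EuclideanSpace ℝ (Fin d)) j)) _ α :=
      HasDerivAt.scomp α (hg _ (hmem α x)) hin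
    refine (hout.fun_smul hcomp).congr_deriv ?_
    simp only [Φ']
    module
  obtain ⟨A, hA⟩ := isCompact_Icc.exists_bound_of_continuousOn hgc
  obtain ⟨B, hB⟩ := isCompact_Icc.exists_bound_of_continuousOn hg'
  have hbound : ∀ α x, ‖Φ' α x‖ ≤ 2 * B + 2 * A := by
    intro α x
    have h1 := abs_le.2 (hmem α x)
    have h2 := abs_le.2 (hmem' α x)
    have hA0 := (norm_nonneg _).trans (hA _ (hmem α x))
    have hB0 := (norm_nonneg _).trans (hB _ (hmem α x))
    refine (norm_add_le _ _).trans (add_le_add ?_ ?_)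
    · rw [norm_smul, norm_smul, Real.norm_eq_abs, Real.norm_eq_abs, abs_mul, ← mul_assoc]
      refine mul_le_mul ?_ (hB _ (hmem α x)) (norm_nonneg _) (by norm_num)
      norm_num
      nlinarith [abs_nonneg (Real.sin (2 * α) * (x : EuclideanSpace ℝ (Fin d)) i -
        Real.cos (2 * α) * (x : EuclideanSpace ℝ (Fin d)) j)]
    · rw [norm_smul, Real.norm_eq_abs, abs_mul]
      refine mul_le_mul ?_ (hA _ (hmem α x)) (norm_nonneg _) (by norm_num)
      norm_num
      linarith
  have key := (hasDerivAt_integral_of_dominated_loc_of_deriv_le (μ := surfaceMeasure d)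
    (F := Φ) (F' := Φ') (x₀ := 0) (s := Set.univ) (bound := fun _ => 2 * B + 2 * A)
    Filter.univ_mem (Filter.Eventually.of_forall fun α => (hcont α).aestronglyMeasurable)
    (integrable_of_continuous (hcont 0)) (hcont' 0).aestronglyMeasurable
    (Filter.Eventually.of_forall fun x α _ => hbound α x) (integrable_const _)
    (Filter.Eventually.of_forall fun x α _ => hderiv α x)).2
  have hconst : ∀ α, ∫ x, Φ α x ∂surfaceMeasure d = ∫ x : UnitSphere d,
      (x : EuclideanSpace ℝ (Fin d)) j • g ((x : EuclideanSpace ℝ (Fin d)) i)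
        ∂surfaceMeasure d := by
    intro α
    have hc : Continuous fun x : UnitSphere d => (x : EuclideanSpace ℝ (Fin d)) j •
        g ((x : EuclideanSpace ℝ (Fin d)) i) :=
      (continuous_coord j).smul (continuous_comp_coord hgc i)
    rw [← integral_comp_sphereMap (L α) hc]
    simp only [Φ, sphereMap, (hL α _).1, (hL α _).2]
  have hzero := key.unique ((hasDerivAt_const (0 : ℝ) _).congr_of_eventuallyEq
    (Filter.Eventually.of_forall hconst))
  have e : ∀ x, Φ' 0 x = (2 : ℝ) • ((x : EuclideanSpace ℝ (Fin d)) i •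
      g ((x : EuclideanSpace ℝ (Fin d)) i) - (x : EuclideanSpace ℝ (Fin d)) j ^ 2 •
        g' ((x : EuclideanSpace ℝ (Fin d)) i)) := by
    intro x
    simp only [Φ', mul_zero, Real.sin_zero, Real.cos_zero, zero_mul, one_mul, add_zero, zero_sub]
    module
  simp only [e] at hzero
  rw [integral_smul, integral_sub, smul_eq_zero_iff_right two_ne_zero, sub_eq_zero] at hzero
  · exact hzero
  · exact integrable_of_continuous ((continuous_coord i).smul (continuous_comp_coord hgc i))
  · exact integrable_of_continuous (((continuous_coord j).pow 2).smul (continuous_comp_coord hg' i))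

/-- Integration by parts for the distribution of one coordinate of a random point of the sphere. -/
theorem integral_coord_smul_eq {F : Type*} [NormedAddCommGroup F] [NormedSpace ℝ F]
    [CompleteSpace F] {g g' : ℝ → F}
    (hg : ∀ x ∈ Set.Icc (-1 : ℝ) 1, HasDerivAt g (g' x) x)
    (hg' : ContinuousOn g' (Set.Icc (-1) 1)) (i : Fin d) :
    ((d : ℝ) - 1) • ∫ x : UnitSphere d, (x : EuclideanSpace ℝ (Fin d)) i •
        g ((x : EuclideanSpace ℝ (Fin d)) i) ∂surfaceMeasure d =
      ∫ x : UnitSphere d, (1 - (x : EuclideanSpace ℝ (Fin d)) i ^ 2) •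
        g' ((x : EuclideanSpace ℝ (Fin d)) i) ∂surfaceMeasure d := by
  have h1 : ∀ x : UnitSphere d, (1 - (x : EuclideanSpace ℝ (Fin d)) i ^ 2) •
        g' ((x : EuclideanSpace ℝ (Fin d)) i) = ∑ j ∈ Finset.univ.erase i,
        (x : EuclideanSpace ℝ (Fin d)) j ^ 2 • g' ((x : EuclideanSpace ℝ (Fin d)) i) := by
    intro x
    rw [← Finset.sum_smul, ← sum_coord_sq x, ← Finset.add_sum_erase _ _ (Finset.mem_univ i),
      add_sub_cancel_left]
  simp only [h1]
  have hint : ∀ j ∈ Finset.univ.erase i, Integrable (fun x : UnitSphere d =>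
      (x : EuclideanSpace ℝ (Fin d)) j ^ 2 • g' ((x : EuclideanSpace ℝ (Fin d)) i))
      (surfaceMeasure d) := fun j _ =>
    integrable_of_continuous (((continuous_coord j).pow 2).smul (continuous_comp_coord hg' i))
  rw [integral_finsetSum _ hint,
    Finset.sum_congr rfl fun j hj =>
      (integral_coord_smul hg hg' (Finset.ne_of_mem_erase hj).symm).symm,
    Finset.sum_const, Finset.card_erase_of_mem (Finset.mem_univ i), Finset.card_univ,
    Fintype.card_fin, ← Nat.cast_smul_eq_nsmul ℝ, Nat.cast_sub (Fin.pos i), Nat.cast_one]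

end SphericalMaximal

namespace SphericalMaximal

variable {d : ℕ}

/-- The total area of the unit sphere of `ℝ^d`. -/
noncomputable def sphereArea (d : ℕ) : ℝ := (surfaceMeasure d).real Set.univ

theorem sphereArea_nonneg (d : ℕ) : 0 ≤ sphereArea d := measureReal_nonneg

section CoordIntegral

variable {F : Type*} [NormedAddCommGroup F] [NormedSpace ℝ F]

/-- The integral over the unit sphere of a function of the coordinate `i`. -/
noncomputable def coordIntegral (i : Fin d) (f : ℝ → F) : F :=
  ∫ x : UnitSphere d, f ((x : EuclideanSpace ℝ (Fin d)) i) ∂surfaceMeasure d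

variable {i : Fin d}

theorem coordIntegral_congr {f g : ℝ → F} (h : ∀ x ∈ Set.Icc (-1 : ℝ) 1, f x = g x) :
    coordIntegral i f = coordIntegral i g :=
  integral_congr_ae (Filter.Eventually.of_forall fun x => h _ (coord_mem_Icc x i))

theorem coordIntegral_add {f g : ℝ → F} (hf : ContinuousOn f (Set.Icc (-1) 1))
    (hg : ContinuousOn g (Set.Icc (-1) 1)) :
    coordIntegral i (fun x => f x + g x) = coordIntegral i f + coordIntegral i g :=
  integral_add (integrable_of_continuous (continuous_comp_coord hf i))
    (integrable_of_continuous (continuous_comp_coord hg i))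

theorem coordIntegral_sub {f g : ℝ → F} (hf : ContinuousOn f (Set.Icc (-1) 1))
    (hg : ContinuousOn g (Set.Icc (-1) 1)) :
    coordIntegral i (fun x => f x - g x) = coordIntegral i f - coordIntegral i g :=
  integral_sub (integrable_of_continuous (continuous_comp_coord hf i))
    (integrable_of_continuous (continuous_comp_coord hg i))

theorem coordIntegral_smul {𝕜 : Type*} [RCLike 𝕜] [NormedSpace 𝕜 F]
    (c : 𝕜) (f : ℝ → F) :
    coordIntegral i (fun x => c • f x) = c • coordIntegral i f :=
  integral_smul _ _

theorem coordIntegral_const [CompleteSpace F] (c : F) :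
    coordIntegral i (fun _ => c) = sphereArea d • c :=
  integral_const _

theorem coordIntegral_mono {f g : ℝ → ℝ} (hf : ContinuousOn f (Set.Icc (-1) 1))
    (hg : ContinuousOn g (Set.Icc (-1) 1)) (h : ∀ x ∈ Set.Icc (-1 : ℝ) 1, f x ≤ g x) :
    coordIntegral i f ≤ coordIntegral i g :=
  integral_mono (integrable_of_continuous (continuous_comp_coord hf i))
    (integrable_of_continuous (continuous_comp_coord hg i)) fun x => h _ (coord_mem_Icc x i)

theorem norm_coordIntegral_le {f : ℝ → F} {g : ℝ → ℝ} (hg : ContinuousOn g (Set.Icc (-1) 1))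
    (h : ∀ x ∈ Set.Icc (-1 : ℝ) 1, ‖f x‖ ≤ g x) : ‖coordIntegral i f‖ ≤ coordIntegral i g :=
  norm_integral_le_of_norm_le (integrable_of_continuous (continuous_comp_coord hg i))
    (Filter.Eventually.of_forall fun x => h _ (coord_mem_Icc x i))

theorem coordIntegral_id_smul [CompleteSpace F] {g g' : ℝ → F}
    (hg : ∀ x ∈ Set.Icc (-1 : ℝ) 1, HasDerivAt g (g' x) x)
    (hg' : ContinuousOn g' (Set.Icc (-1) 1)) (i : Fin d) :
    ((d : ℝ) - 1) • coordIntegral i (fun x => x • g x) =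
      coordIntegral i fun x => (1 - x ^ 2) • g' x :=
  integral_coord_smul_eq hg hg' i

end CoordIntegral

variable (i : Fin d)

theorem coordIntegral_id (hd : 2 ≤ d) : coordIntegral i (fun x => x) = 0 := by
  have h := coordIntegral_id_smul (g := fun _ => (1 : ℝ)) (g' := fun _ => 0)
    (fun x _ => hasDerivAt_const x 1) continuousOn_const i
  simp only [smul_eq_mul, mul_one, mul_zero] at h
  rw [coordIntegral_const, smul_zero] at h
  have hd' : (2 : ℝ) ≤ d := by exact_mod_cast hd
  exact (mul_eq_zero.1 h).resolve_left (by linarith)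

theorem coordIntegral_sq : d * coordIntegral i (fun x => x ^ 2) = sphereArea d := by
  have h := coordIntegral_id_smul (g := fun x : ℝ => x) (g' := fun _ => 1)
    (fun x _ => hasDerivAt_id x) continuousOn_const i
  simp only [smul_eq_mul, mul_one, ← sq] at h
  rw [coordIntegral_sub continuousOn_const (by fun_prop), coordIntegral_const] at h
  simp only [smul_eq_mul, mul_one] at h
  linarith

section Regularized

variable {ε : ℝ}

theorem regularized_pos (hε : 0 < ε) {x : ℝ} (hx : x ∈ Set.Icc (-1 : ℝ) 1) :
    0 < 1 - x ^ 2 + ε := by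
  have := (sq_le_one_iff_abs_le_one x).2 (abs_le.2 hx)
  linarith

theorem one_sub_sq_nonneg {x : ℝ} (hx : x ∈ Set.Icc (-1 : ℝ) 1) : 0 ≤ 1 - x ^ 2 := by
  have := (sq_le_one_iff_abs_le_one x).2 (abs_le.2 hx)
  linarith

theorem continuousOn_div_regularized (hε : 0 < ε) {f : ℝ → ℝ} (hf : Continuous f) :
    ContinuousOn (fun x => f x / (1 - x ^ 2 + ε)) (Set.Icc (-1) 1) :=
  hf.continuousOn.div (by fun_prop) fun _ hx => (regularized_pos hε hx).ne'

theorem continuousOn_div_regularized_sq (hε : 0 < ε) {f : ℝ → ℝ} (hf : Continuous f) :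
    ContinuousOn (fun x => f x / (1 - x ^ 2 + ε) ^ 2) (Set.Icc (-1) 1) :=
  hf.continuousOn.div (by fun_prop) fun _ hx => (pow_pos (regularized_pos hε hx) 2).ne'

theorem hasDerivAt_regularized (x : ℝ) : HasDerivAt (fun x : ℝ => 1 - x ^ 2 + ε) (-2 * x) x := by
  have := (((hasDerivAt_id x).pow 2).const_sub 1).add_const ε
  refine this.congr_deriv ?_
  simp

/-- The identity `coordIntegral_id_smul` for `g x = x / (1 - x² + ε)`. The regularization `ε` makes
`g` differentiable at the poles `x = ±1`; the bound does not depend on it. -/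
theorem coordIntegral_sq_div_le (hε : 0 < ε) :
    ((d : ℝ) - 3) * coordIntegral i (fun x => x ^ 2 / (1 - x ^ 2 + ε)) ≤ sphereArea d := by
  have h := coordIntegral_id_smul (g := fun x : ℝ => x / (1 - x ^ 2 + ε))
    (g' := fun x => 1 / (1 - x ^ 2 + ε) + 2 * x ^ 2 / (1 - x ^ 2 + ε) ^ 2)
    (fun x hx => by
      have hD := (regularized_pos hε hx).ne'
      refine ((hasDerivAt_id x).div (hasDerivAt_regularized x) hD).congr_deriv ?_
      simp only [id]
      field_simp
      ring)
    ((continuousOn_div_regularized hε continuous_const).add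
      (continuousOn_div_regularized_sq hε (by fun_prop))) i
  have c₁ : ContinuousOn (fun x : ℝ => (2 : ℝ) • (x ^ 2 / (1 - x ^ 2 + ε))) (Set.Icc (-1) 1) :=
    (continuousOn_div_regularized hε (f := fun x => x ^ 2) (by fun_prop)).fun_const_smul _
  have c₂ : ContinuousOn (fun x : ℝ => 1 / (1 - x ^ 2 + ε) + 2 * x ^ 2 / (1 - x ^ 2 + ε) ^ 2)
      (Set.Icc (-1) 1) :=
    (continuousOn_div_regularized hε continuous_const).add
      (continuousOn_div_regularized_sq hε (by fun_prop))
  have h1 : coordIntegral i (fun x => (1 - x ^ 2) •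
      (1 / (1 - x ^ 2 + ε) + 2 * x ^ 2 / (1 - x ^ 2 + ε) ^ 2)) ≤
      coordIntegral i fun x => 1 + (2 : ℝ) • (x ^ 2 / (1 - x ^ 2 + ε)) := by
    refine coordIntegral_mono ?_ ?_ fun x hx => ?_
    · exact ContinuousOn.smul (f := fun x : ℝ => 1 - x ^ 2) (by fun_prop) c₂
    · exact continuousOn_const.add c₁
    · have hD := regularized_pos hε hx
      have hq : (1 - x ^ 2) / (1 - x ^ 2 + ε) ≤ 1 := by rw [div_le_one hD]; linarith
      have e : (1 - x ^ 2) • (1 / (1 - x ^ 2 + ε) + 2 * x ^ 2 / (1 - x ^ 2 + ε) ^ 2) =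
          (1 - x ^ 2) / (1 - x ^ 2 + ε) * (1 + 2 * (x ^ 2 / (1 - x ^ 2 + ε))) := by
        rw [smul_eq_mul]; field_simp
      rw [e, smul_eq_mul]
      exact mul_le_of_le_one_left (by positivity) hq
  rw [← h, coordIntegral_add continuousOn_const c₁, coordIntegral_smul,
    coordIntegral_const] at h1
  have e : (fun x : ℝ => x • (x / (1 - x ^ 2 + ε))) = fun x => x ^ 2 / (1 - x ^ 2 + ε) := by
    funext x; rw [smul_eq_mul]; ring
  rw [e] at h1
  simp only [smul_eq_mul, mul_one] at h1
  linarith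

theorem coordIntegral_one_div_le (hd : 4 ≤ d) (hε : 0 < ε) :
    coordIntegral i (fun x => 1 / (1 - x ^ 2 + ε)) ≤ 2 * sphereArea d := by
  have h := coordIntegral_sq_div_le i hε
  have hd' : (4 : ℝ) ≤ d := by exact_mod_cast hd
  have h1 : coordIntegral i (fun x => 1 / (1 - x ^ 2 + ε)) ≤
      coordIntegral i fun x => 1 + x ^ 2 / (1 - x ^ 2 + ε) := by
    refine coordIntegral_mono (continuousOn_div_regularized hε continuous_const)
      (continuousOn_const.add (continuousOn_div_regularized hε (by fun_prop))) fun x hx => ?_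
    have hD := regularized_pos hε hx
    rw [div_le_iff₀ hD]
    field_simp
    linarith
  have h0 : 0 ≤ coordIntegral i (fun x => x ^ 2 / (1 - x ^ 2 + ε)) :=
    integral_nonneg fun x => by
      have := regularized_pos hε (coord_mem_Icc x i)
      positivity
  rw [coordIntegral_add continuousOn_const (continuousOn_div_regularized hε (by fun_prop)),
    coordIntegral_const] at h1
  simp only [smul_eq_mul, mul_one] at h1
  nlinarith

/-- Obtained from the pointwise inequality `2 |x| ≤ √d x² + 1 / √d`. -/
theorem coordIntegral_abs_div_le (hd : 6 ≤ d) (hε : 0 < ε) :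
    coordIntegral i (fun x => |x| / (1 - x ^ 2 + ε)) ≤ 2 / √d * sphereArea d := by
  have h1 := coordIntegral_sq_div_le i hε
  have h2 := coordIntegral_one_div_le i (by omega) hε
  have hd' : (6 : ℝ) ≤ d := by exact_mod_cast hd
  have hs : 0 < √(d : ℝ) := Real.sqrt_pos.2 (by linarith)
  have hss : √(d : ℝ) * √d = d := Real.mul_self_sqrt (by linarith)
  have c₁ : ContinuousOn (fun x : ℝ => (√d / 2) • (x ^ 2 / (1 - x ^ 2 + ε))) (Set.Icc (-1) 1) :=
    (continuousOn_div_regularized hε (f := fun x => x ^ 2) (by fun_prop)).fun_const_smul _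
  have c₂ : ContinuousOn (fun x : ℝ => (1 / (2 * √d)) • (1 / (1 - x ^ 2 + ε))) (Set.Icc (-1) 1) :=
    (continuousOn_div_regularized hε continuous_const).fun_const_smul _
  have h3 : coordIntegral i (fun x => |x| / (1 - x ^ 2 + ε)) ≤
      coordIntegral i fun x => (√d / 2) • (x ^ 2 / (1 - x ^ 2 + ε)) +
        (1 / (2 * √d)) • (1 / (1 - x ^ 2 + ε)) := by
    refine coordIntegral_mono (continuousOn_div_regularized hε continuous_abs) (c₁.add c₂) fun x hx => ?_
    have hD := regularized_pos hε hx
    rw [smul_eq_mul, smul_eq_mul, ← mul_div_assoc, ← mul_div_assoc, ← add_div]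
    refine div_le_div_of_nonneg_right ?_ hD.le
    have e : √(d : ℝ) / 2 * x ^ 2 + 1 / (2 * √d) * 1 - |x| = (√d * |x| - 1) ^ 2 / (2 * √d) := by
      rw [← sq_abs x]; field_simp; ring
    have : 0 ≤ (√(d : ℝ) * |x| - 1) ^ 2 / (2 * √d) := by positivity
    linarith
  rw [coordIntegral_add c₁ c₂, coordIntegral_smul,
    coordIntegral_smul] at h3
  simp only [smul_eq_mul] at h3
  refine h3.trans ?_
  have h4 : coordIntegral i (fun x => x ^ 2 / (1 - x ^ 2 + ε)) ≤ 2 / d * sphereArea d := by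
    rw [div_mul_eq_mul_div, le_div_iff₀ (by linarith)]
    have h0 : 0 ≤ coordIntegral i (fun x => x ^ 2 / (1 - x ^ 2 + ε)) :=
      integral_nonneg fun x => by
        have := regularized_pos hε (coord_mem_Icc x i)
        positivity
    nlinarith
  calc _ ≤ √d / 2 * (2 / d * sphereArea d) + 1 / (2 * √d) * (2 * sphereArea d) := by gcongr
    _ = (√d / d + 1 / √d) * sphereArea d := by field_simp
    _ = _ := by
      congr 1
      rw [← hss]
      field_simp
      norm_num
      ring

end Regularized

/-- Integrating by parts against `exp (isx) / (1 - x² + ε)` trades the oscillation for a factor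
`1 / s`; as `ε → 0` the weight `(1 - x²) / (1 - x² + ε)` disappears. The gain over integrating by
parts without the denominator is that no error term of order `1 / d` remains. -/
theorem mul_norm_coordIntegral_exp_le (hd : 6 ≤ d) (s : ℝ) :
    |s| * ‖coordIntegral i fun x => Complex.exp (s * x * Complex.I)‖ ≤ 4 * √d * sphereArea d := by
  have hd' : (6 : ℝ) ≤ d := by exact_mod_cast hd
  have hs : 0 < √(d : ℝ) := Real.sqrt_pos.2 (by linarith)
  have hss : √(d : ℝ) * √d = d := Real.mul_self_sqrt (by linarith)
  have hσ := sphereArea_nonneg d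
  set e : ℝ → ℂ := fun x => Complex.exp (s * x * Complex.I) with he
  have hec : Continuous e := by fun_prop
  have hen : ∀ x, ‖e x‖ = 1 := fun x => by
    rw [he]; simpa using Complex.norm_exp_ofReal_mul_I (s * x)
  have main : ∀ ε : ℝ, 0 < ε →
      |s| * ‖coordIntegral i e‖ ≤ 4 * √d * sphereArea d + ε * (2 * |s| * sphereArea d) := by
    intro ε hε
    have cinv : ContinuousOn (fun x : ℝ => (1 - x ^ 2 + ε)⁻¹) (Set.Icc (-1) 1) :=
      ContinuousOn.inv₀ (by fun_prop) fun _ hx => (regularized_pos hε hx).ne'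
    have c1 : ContinuousOn (fun x : ℝ => (1 - x ^ 2 + ε)⁻¹ • (e x * (s * Complex.I)))
        (Set.Icc (-1) 1) := cinv.smul (hec.mul continuous_const).continuousOn
    have c1' : ContinuousOn (fun x : ℝ => (2 * x * (1 - x ^ 2 + ε)⁻¹ ^ 2) • e x)
        (Set.Icc (-1) 1) :=
      (ContinuousOn.mul (by fun_prop) (cinv.pow 2)).smul hec.continuousOn
    have h := coordIntegral_id_smul (g := fun x : ℝ => (1 - x ^ 2 + ε)⁻¹ • e x)
      (g' := fun x => (1 - x ^ 2 + ε)⁻¹ • (e x * (s * Complex.I)) +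
        (2 * x * (1 - x ^ 2 + ε)⁻¹ ^ 2) • e x)
      (fun x hx => by
        have hD := (regularized_pos hε hx).ne'
        have h1 := (hasDerivAt_regularized (ε := ε) x).fun_inv hD
        have h2 : HasDerivAt e (e x * (s * Complex.I)) x := by
          have h3 : HasDerivAt (fun x : ℝ => (s * x * Complex.I : ℂ)) (s * Complex.I) x := by
            have := ((Complex.ofRealCLM.hasDerivAt (x := x)).const_mul (s : ℂ)).mul_const Complex.I
            simpa using this
          exact h3.cexp
        refine (h1.fun_smul h2).congr_deriv ?_
        congr 2
        field_simp)
      (c1.add c1') i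
    have e1 : coordIntegral i (fun x => (1 - x ^ 2) • ((1 - x ^ 2 + ε)⁻¹ • (e x * (s * Complex.I)) +
        (2 * x * (1 - x ^ 2 + ε)⁻¹ ^ 2) • e x)) =
        coordIntegral i (fun x => (s * Complex.I) • e x + ((-(s * ε * Complex.I)) •
          ((1 - x ^ 2 + ε)⁻¹ • e x) +
          ((1 - x ^ 2) * (2 * x * (1 - x ^ 2 + ε)⁻¹ ^ 2)) • e x)) := by
      refine coordIntegral_congr fun x hx => ?_
      have hD := (regularized_pos hε hx).ne'
      have h5 : (1 - x ^ 2) * (1 - x ^ 2 + ε)⁻¹ = 1 - ε * (1 - x ^ 2 + ε)⁻¹ := by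
        field_simp
        ring
      rw [smul_add, smul_smul, smul_smul, h5, ← add_assoc]
      congr 1
      simp only [smul_eq_mul, Complex.real_smul]
      push_cast
      ring
    have c0 : ContinuousOn (fun x : ℝ => (1 - x ^ 2 + ε)⁻¹ • e x) (Set.Icc (-1) 1) :=
      cinv.smul hec.continuousOn
    have c2 : ContinuousOn (fun x => (-(s * ε * Complex.I)) • ((1 - x ^ 2 + ε)⁻¹ • e x))
        (Set.Icc (-1) 1) :=
      c0.fun_const_smul _
    have c3 : ContinuousOn (fun x => ((1 - x ^ 2) * (2 * x * (1 - x ^ 2 + ε)⁻¹ ^ 2)) • e x)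
        (Set.Icc (-1) 1) :=
      ContinuousOn.smul (ContinuousOn.mul (by fun_prop)
        (ContinuousOn.mul (by fun_prop) (cinv.pow 2))) hec.continuousOn
    have c4 : ContinuousOn (fun x : ℝ => (s * Complex.I : ℂ) • e x) (Set.Icc (-1) 1) :=
      (hec.fun_const_smul _).continuousOn
    rw [e1, coordIntegral_add c4 (c2.fun_add c3),
      coordIntegral_add c2 c3, coordIntegral_smul, coordIntegral_smul] at h
    have n1 : ‖coordIntegral i (fun x => x • ((1 - x ^ 2 + ε)⁻¹ • e x))‖ ≤
        2 / √d * sphereArea d := by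
      refine (norm_coordIntegral_le (continuousOn_div_regularized hε continuous_abs)
        fun x hx => ?_).trans (coordIntegral_abs_div_le i hd hε)
      rw [norm_smul, norm_smul, hen, Real.norm_eq_abs, Real.norm_eq_abs, abs_inv,
        abs_of_pos (regularized_pos hε hx), mul_one, div_eq_mul_inv]
    have n2 : ‖coordIntegral i (fun x => (1 - x ^ 2 + ε)⁻¹ • e x)‖ ≤ 2 * sphereArea d := by
      refine (norm_coordIntegral_le (continuousOn_div_regularized hε continuous_const)
        fun x hx => ?_).trans (coordIntegral_one_div_le i (by omega) hε)
      rw [norm_smul, hen, Real.norm_eq_abs, abs_inv,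
        abs_of_pos (regularized_pos hε hx), mul_one, one_div]
    have n3 : ‖coordIntegral i (fun x =>
        ((1 - x ^ 2) * (2 * x * (1 - x ^ 2 + ε)⁻¹ ^ 2)) • e x)‖ ≤
        2 * (2 / √d * sphereArea d) := by
      have : (2 : ℝ) * coordIntegral i (fun x => |x| / (1 - x ^ 2 + ε)) ≤
          2 * (2 / √d * sphereArea d) := by
        have := coordIntegral_abs_div_le i hd hε
        linarith
      rw [← smul_eq_mul, ← coordIntegral_smul] at this
      refine (norm_coordIntegral_le
        ((continuousOn_div_regularized hε continuous_abs).fun_const_smul (2 : ℝ))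
        fun x hx => ?_).trans this
      have hD := regularized_pos hε hx
      have hq : (1 - x ^ 2) * (1 - x ^ 2 + ε)⁻¹ ≤ 1 := by
        rw [mul_inv_le_iff₀ hD]; linarith
      have hq0 : 0 ≤ (1 - x ^ 2) * (1 - x ^ 2 + ε)⁻¹ :=
        mul_nonneg (one_sub_sq_nonneg hx) (inv_nonneg.2 hD.le)
      rw [norm_smul, hen, mul_one, Real.norm_eq_abs,
        show (1 - x ^ 2) * (2 * x * (1 - x ^ 2 + ε)⁻¹ ^ 2) =
          ((1 - x ^ 2) * (1 - x ^ 2 + ε)⁻¹) * (2 * (x * (1 - x ^ 2 + ε)⁻¹)) by ring,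
        abs_mul, abs_of_nonneg hq0, abs_mul, abs_mul, abs_inv, abs_of_pos hD, abs_two, smul_eq_mul,
        div_eq_mul_inv]
      exact mul_le_of_le_one_left (by positivity) hq
    have h6 : (s * Complex.I) • coordIntegral i e =
        ((d : ℝ) - 1) • coordIntegral i (fun x => x • ((1 - x ^ 2 + ε)⁻¹ • e x)) +
        (s * ε * Complex.I) • coordIntegral i (fun x => (1 - x ^ 2 + ε)⁻¹ • e x) -
        coordIntegral i (fun x => ((1 - x ^ 2) * (2 * x * (1 - x ^ 2 + ε)⁻¹ ^ 2)) • e x) := by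
      rw [h, neg_smul]
      abel
    have h7 := congrArg norm h6
    rw [norm_smul] at h7
    have hsn : ‖(s * Complex.I : ℂ)‖ = |s| := by simp
    have hsn2 : ‖(s * ε * Complex.I : ℂ)‖ = |s| * ε := by simp [abs_of_pos hε]
    have hdn : ‖(d : ℝ) - 1‖ = d - 1 := by rw [Real.norm_eq_abs, abs_of_nonneg (by linarith)]
    rw [hsn] at h7
    rw [h7]
    refine (norm_sub_le _ _).trans ?_
    refine (add_le_add (norm_add_le _ _) n3).trans ?_
    rw [norm_smul, norm_smul, hsn2, hdn]
    have h8 : ((d : ℝ) - 1) * (2 / √d * sphereArea d) + 2 * (2 / √d * sphereArea d) ≤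
        4 * √d * sphereArea d := by
      have : ((d : ℝ) - 1) * (2 / √d) + 2 * (2 / √d) ≤ 4 * √d := by
        rw [← add_mul, ← mul_div_assoc, div_le_iff₀ hs]
        nlinarith
      nlinarith
    have h9 := mul_le_mul_of_nonneg_left n1 (by linarith : (0 : ℝ) ≤ (d : ℝ) - 1)
    have h10 := mul_le_mul_of_nonneg_left n2 (by positivity : (0 : ℝ) ≤ |s| * ε)
    linarith
  have hK : 0 ≤ 2 * |s| * sphereArea d := by positivity
  refine le_of_forall_pos_le_add fun δ hδ => ?_
  refine (main (δ / (2 * |s| * sphereArea d + 1)) (by positivity)).trans ?_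
  have : δ / (2 * |s| * sphereArea d + 1) * (2 * |s| * sphereArea d) ≤ δ := by
    rw [div_mul_eq_mul_div, div_le_iff₀ (by linarith)]
    nlinarith
  linarith

/-- The linear term of the exponential integrates to zero, and the mean of `x²` is `1 / d`. -/
theorem norm_coordIntegral_exp_sub_le (hd : 2 ≤ d) (s : ℝ) :
    ‖coordIntegral i (fun x => Complex.exp (s * x * Complex.I)) - sphereArea d‖ ≤
      3 * s ^ 2 / d * sphereArea d := by
  have hd' : (2 : ℝ) ≤ d := by exact_mod_cast hd
  have h1 : coordIntegral i (fun x : ℝ => Complex.exp (s * x * Complex.I)) - sphereArea d =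
      coordIntegral i (fun x : ℝ => Complex.exp (s * x * Complex.I) - 1 - s * x * Complex.I) := by
    rw [coordIntegral_sub (by fun_prop) (by fun_prop), coordIntegral_sub (by fun_prop) (by fun_prop),
      coordIntegral_const]
    have : coordIntegral i (fun x : ℝ => (s * x * Complex.I : ℂ)) = 0 := by
      have e : (fun x : ℝ => (s * x * Complex.I : ℂ)) = fun x : ℝ => (s * Complex.I) • (x : ℂ) := by
        funext x; rw [smul_eq_mul]; ring
      rw [e, coordIntegral_smul]
      have : coordIntegral i (fun x : ℝ => (x : ℂ)) = ((coordIntegral i fun x => x : ℝ) : ℂ) :=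
        integral_ofReal
      rw [this, coordIntegral_id i hd]
      simp
    rw [this]
    simp
  have h2 : 3 * s ^ 2 / d * sphereArea d = coordIntegral i fun x => (3 * s ^ 2) • x ^ 2 := by
    rw [coordIntegral_smul, ← coordIntegral_sq i, smul_eq_mul]
    field_simp
  rw [h1, h2]
  refine norm_coordIntegral_le (by fun_prop) fun x _ => ?_
  have hn : ‖(s * x * Complex.I : ℂ)‖ = |s * x| := by simp
  rw [smul_eq_mul, show 3 * s ^ 2 * x ^ 2 = 3 * |s * x| ^ 2 by rw [sq_abs]; ring]
  rcases le_or_gt |s * x| 1 with h | h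
  · refine (Complex.norm_exp_sub_one_sub_id_le (by rwa [hn])).trans ?_
    rw [hn]
    nlinarith [sq_nonneg |s * x|]
  · refine (norm_sub_le _ _).trans ?_
    have h3 : ‖Complex.exp (s * x * Complex.I) - 1‖ ≤ 2 := by
      refine (norm_sub_le _ _).trans ?_
      have := Complex.norm_exp_ofReal_mul_I (s * x)
      push_cast at this
      rw [this]
      norm_num
    rw [hn]
    nlinarith

theorem sphereFourier_eq_coordIntegral (i : Fin d) (η : EuclideanSpace ℝ (Fin d)) :
    sphereFourier η = coordIntegral i fun x =>
      Complex.exp ((-(2 * Real.pi * ‖η‖) : ℝ) * x * Complex.I) := by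
  -- a reflection takes `η` to a multiple of the basis vector
  obtain ⟨L, hL⟩ : ∃ L : EuclideanSpace ℝ (Fin d) ≃ₗᵢ[ℝ] EuclideanSpace ℝ (Fin d),
      L η = ‖η‖ • EuclideanSpace.single i 1 := by
    refine ⟨_, Submodule.reflection_sub (v := η) (w := ‖η‖ • EuclideanSpace.single i 1) ?_⟩
    simp [norm_smul]
  have hc : Continuous fun x : UnitSphere d => Complex.exp (-(2 * Real.pi * Complex.I *
      (inner ℝ (L η) (x : EuclideanSpace ℝ (Fin d)) : ℝ))) := by fun_prop
  have h := integral_comp_sphereMap L hc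
  have e1 : ∀ x : UnitSphere d, inner ℝ (L η) (sphereMap L x : EuclideanSpace ℝ (Fin d)) =
      inner ℝ η (x : EuclideanSpace ℝ (Fin d)) := fun x => L.inner_map_map _ _
  simp only [e1] at h
  rw [sphereFourier, coordIntegral]
  refine h.trans (integral_congr_ae (Filter.Eventually.of_forall fun x => ?_))
  simp only [hL, inner_smul_left, EuclideanSpace.inner_single_left]
  congr 1
  simp
  ring

/-- Decay of the Fourier transform of the sphere, on the scale `√d` natural to a coordinate of a
random point. -/
theorem norm_mul_norm_sphereFourier_le (hd : 6 ≤ d) (η : EuclideanSpace ℝ (Fin d)) :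
    ‖η‖ * ‖sphereFourier η‖ ≤ √d * sphereArea d := by
  have h := mul_norm_coordIntegral_exp_le (⟨0, by omega⟩ : Fin d) hd (-(2 * Real.pi * ‖η‖))
  rw [← sphereFourier_eq_coordIntegral, abs_neg, abs_of_nonneg (by positivity)] at h
  have hpi := Real.pi_gt_three
  have h0 : 0 ≤ ‖η‖ * ‖sphereFourier η‖ := by positivity
  nlinarith

theorem norm_sphereFourier_sub_le (hd : 2 ≤ d) (η : EuclideanSpace ℝ (Fin d)) :
    ‖sphereFourier η - sphereArea d‖ ≤ 120 * (‖η‖ ^ 2 / d) * sphereArea d := by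
  have h := norm_coordIntegral_exp_sub_le (⟨0, by omega⟩ : Fin d) hd (-(2 * Real.pi * ‖η‖))
  rw [← sphereFourier_eq_coordIntegral] at h
  refine h.trans ?_
  have hpi : Real.pi ^ 2 ≤ 10 := by nlinarith [Real.pi_lt_d2, Real.pi_pos]
  have e : 3 * (-(2 * Real.pi * ‖η‖)) ^ 2 / d = 12 * Real.pi ^ 2 * (‖η‖ ^ 2 / d) := by ring
  rw [e]
  gcongr
  · exact sphereArea_nonneg d
  · linarith

theorem norm_sphereFourier_le (η : EuclideanSpace ℝ (Fin d)) :
    ‖sphereFourier η‖ ≤ sphereArea d := by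
  refine (norm_integral_le_of_norm_le_const (C := 1)
    (Filter.Eventually.of_forall fun x => ?_)).trans (by rw [one_mul]; rfl)
  refine le_of_eq ?_
  rw [show (-(2 * Real.pi * Complex.I * (inner ℝ η (x : EuclideanSpace ℝ (Fin d)) : ℝ)) : ℂ) =
    ((-(2 * Real.pi * inner ℝ η (x : EuclideanSpace ℝ (Fin d))) : ℝ) : ℂ) * Complex.I by
    push_cast; ring]
  exact Complex.norm_exp_ofReal_mul_I _

theorem continuous_sphereFourier : Continuous (sphereFourier (d := d)) := by
  refine continuous_of_dominated (bound := fun _ => 1) (fun η => ?_) (fun η => ?_)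
    (integrable_const _) (Filter.Eventually.of_forall fun x => by fun_prop)
  · exact Continuous.aestronglyMeasurable (by fun_prop)
  · refine Filter.Eventually.of_forall fun x => le_of_eq ?_
    rw [show (-(2 * Real.pi * Complex.I * (inner ℝ η (x : EuclideanSpace ℝ (Fin d)) : ℝ)) : ℂ) =
      ((-(2 * Real.pi * inner ℝ η (x : EuclideanSpace ℝ (Fin d))) : ℝ) : ℂ) * Complex.I by
      push_cast; ring]
    exact Complex.norm_exp_ofReal_mul_I _

theorem sphereArea_eq (hd : 0 < d) : sphereArea d = d * unitBallVolume d := by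
  rw [sphereArea, Measure.toSphere_real_apply_univ, volume_real_ball hd zero_le_one,
    finrank_euclideanSpace, Fintype.card_fin, one_pow, one_mul]

theorem sphereArea_pos (hd : 0 < d) : 0 < sphereArea d := by
  rw [sphereArea_eq hd]
  have := unitBallVolume_pos d
  positivity

end SphericalMaximal

/-! ### A maximal ergodic theorem for random walks -/

namespace RandomWalk

open Finset

variable {X ι : Type*} [AddCommGroup X] [Fintype ι] {E : Type*} [NormedAddCommGroup E]
  [NormedSpace ℝ E]

/-- The Markov operator of the random walk with equally likely steps `v i`. -/
noncomputable def walk (v : ι → X) (h : X → E) (x : X) : E :=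
  (Fintype.card ι : ℝ)⁻¹ • ∑ i, h (x + v i)

/-- The sum of the first `n` iterates of the Markov operator. -/
noncomputable def walkSum (v : ι → X) (h : X → E) (n : ℕ) (x : X) : E :=
  ∑ k ∈ range n, (walk v)^[k] h x

variable {v : ι → X}

theorem walk_mono {f g : X → ℝ} (hfg : ∀ x, f x ≤ g x) (x : X) : walk v f x ≤ walk v g x :=
  smul_le_smul_of_nonneg_left (sum_le_sum fun i _ => hfg _) (by positivity)

theorem walk_nonneg {f : X → ℝ} (hf : ∀ x, 0 ≤ f x) (x : X) : 0 ≤ walk v f x :=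
  smul_nonneg (by positivity) (sum_nonneg fun i _ => hf _)

theorem iterate_walk_nonneg {f : X → ℝ} (hf : ∀ x, 0 ≤ f x) (k : ℕ) :
    ∀ x, 0 ≤ (walk v)^[k] f x := by
  induction k with
  | zero => exact hf
  | succ k ih => intro x; rw [Function.iterate_succ_apply']; exact walk_nonneg ih x

theorem norm_walk_le (h : X → E) (x : X) : ‖walk v h x‖ ≤ walk v (fun x => ‖h x‖) x := by
  rw [walk, walk, norm_smul, smul_eq_mul, Real.norm_of_nonneg (by positivity)]
  gcongr
  exact norm_sum_le _ _

theorem norm_iterate_walk_le (h : X → E) (k : ℕ) :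
    ∀ x, ‖(walk v)^[k] h x‖ ≤ (walk v)^[k] (fun x => ‖h x‖) x := by
  induction k with
  | zero => exact fun x => le_rfl
  | succ k ih =>
    intro x
    rw [Function.iterate_succ_apply', Function.iterate_succ_apply']
    exact (norm_walk_le _ x).trans (walk_mono ih x)

theorem norm_walkSum_le (h : X → E) (n : ℕ) (x : X) :
    ‖walkSum v h n x‖ ≤ walkSum v (fun x => ‖h x‖) n x :=
  (norm_sum_le _ _).trans (sum_le_sum fun k _ => norm_iterate_walk_le h k x)

theorem walkSum_succ (h : X → E) (n : ℕ) (x : X) :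
    walkSum v h (n + 1) x = h x + walk v (walkSum v h n) x := by
  rw [walkSum, sum_range_succ', add_comm]
  congr 1
  simp only [Function.iterate_succ_apply', walk, walkSum]
  rw [← smul_sum, sum_comm]

theorem walkSum_nonneg {f : X → ℝ} (hf : ∀ x, 0 ≤ f x) (n : ℕ) (x : X) : 0 ≤ walkSum v f n x :=
  sum_nonneg fun k _ => iterate_walk_nonneg hf k x

theorem summable_sq_walk {f : X → ℝ} (hf : Summable fun x => f x ^ 2) :
    Summable fun x => walk v f x ^ 2 := by
  have h1 : Summable fun x => (Fintype.card ι : ℝ)⁻¹ ^ 2 *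
      (Fintype.card ι * ∑ i, f (x + v i) ^ 2) :=
    ((summable_sum fun i _ => (Equiv.addRight (v i)).summable_iff.2 hf).mul_left _).mul_left _
  refine h1.of_nonneg_of_le (fun x => sq_nonneg _) fun x => ?_
  rw [walk, smul_eq_mul, mul_pow]
  gcongr
  exact sq_sum_le_card_mul_sum_sq

theorem summable_sq_iterate_walk {f : X → ℝ} (hf : Summable fun x => f x ^ 2) (k : ℕ) :
    Summable fun x => (walk v)^[k] f x ^ 2 := by
  induction k with
  | zero => exact hf
  | succ k ih => simp only [Function.iterate_succ_apply']; exact summable_sq_walk ih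

theorem summable_sq_walkSum {f : X → ℝ} (hf : Summable fun x => f x ^ 2) (n : ℕ) :
    Summable fun x => walkSum v f n x ^ 2 := by
  have h1 : Summable fun x => ((range n).card : ℝ) * ∑ k ∈ range n, (walk v)^[k] f x ^ 2 :=
    (summable_sum fun k _ => summable_sq_iterate_walk hf k).mul_left _
  exact h1.of_nonneg_of_le (fun x => sq_nonneg _) fun x => sq_sum_le_card_mul_sum_sq

theorem finite_setOf_lt {f : X → ℝ} (hf : Summable fun x => f x ^ 2) {lam : ℝ} (hl : 0 < lam) :
    {x | lam < f x}.Finite := by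
  have h := hf.tendsto_cofinite_zero.eventually (gt_mem_nhds (pow_pos hl 2))
  refine (Filter.eventually_cofinite.1 h).subset fun x hx => ?_
  have hx' : lam < f x := hx
  simp only [Set.mem_ofPred_eq, not_lt]
  gcongr

theorem finite_exceedance {f : X → ℝ} (hf : Summable fun x => f x ^ 2) {lam : ℝ}
    (hl : 0 < lam) (K : ℕ) : {x | ∃ n ≤ K, n * lam < walkSum v f n x}.Finite := by
  refine ((range K).finite_toSet.biUnion fun k _ =>
    finite_setOf_lt (summable_sq_iterate_walk (v := v) hf k) hl).subset ?_
  rintro x ⟨n, hn, hx⟩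
  by_contra hcon
  simp only [Set.mem_iUnion, Set.mem_ofPred_eq, not_exists, not_lt, mem_coe, mem_range] at hcon
  have : walkSum v f n x ≤ ∑ _k ∈ range n, lam :=
    sum_le_sum fun k hk => hcon k ((mem_range.1 hk).trans_le hn)
  rw [sum_const, card_range, nsmul_eq_mul] at this
  linarith

/-- Hopf's maximal ergodic lemma. With `F` the maximum of `0` and of the sums `S n f - n lam`, one has
`F ≤ f - lam + P F` wherever `F` is positive, and `P` does not increase the total sum of `F`. -/
theorem mul_card_exceedance_le [Nonempty ι] {f : X → ℝ} {lam : ℝ} {K : ℕ}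
    (hE : {x | ∃ n ≤ K, n * lam < walkSum v f n x}.Finite) :
    lam * hE.toFinset.card ≤ ∑ x ∈ hE.toFinset, f x := by
  classical
  let F : X → ℝ := fun x => (range (K + 1)).sup' nonempty_range_add_one
    fun n => walkSum v f n x - n * lam
  have hle : ∀ x, ∀ n ≤ K, walkSum v f n x - n * lam ≤ F x := fun x n hn =>
    le_sup' (fun n : ℕ => walkSum v f n x - n * lam) (mem_range.2 (by omega))
  have hF0 : ∀ x, 0 ≤ F x := fun x => by simpa [walkSum] using hle x 0 (Nat.zero_le _)
  have hFE : ∀ x, x ∉ hE.toFinset → F x = 0 := by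
    intro x hx
    refine le_antisymm (sup'_le _ _ fun n hn => ?_) (hF0 x)
    simp only [Set.Finite.mem_toFinset, Set.mem_ofPred_eq, not_exists, not_and, not_lt] at hx
    linarith [hx n (by have := mem_range.1 hn; omega)]
  have key : ∀ x ∈ hE.toFinset, F x ≤ f x - lam + walk v F x := by
    intro x hx
    obtain ⟨n₀, hn₀, hx₀⟩ : ∃ n ≤ K, n * lam < walkSum v f n x := by simpa using hx
    obtain ⟨n, hn, hFn⟩ := exists_mem_eq_sup' (nonempty_range_add_one (n := K))
      fun n : ℕ => walkSum v f n x - n * lam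
    have hFn' : F x = walkSum v f n x - n * lam := hFn
    have hpos : 0 < F x := lt_of_lt_of_le (by linarith) (hle x n₀ hn₀)
    obtain ⟨m, rfl⟩ : ∃ m, n = m + 1 := by
      refine Nat.exists_eq_succ_of_ne_zero ?_
      rintro rfl
      simp [walkSum] at hFn'
      linarith
    have hm : m ≤ K := by have := mem_range.1 hn; omega
    have hw : walk v (walkSum v f m) x - m * lam ≤ walk v F x := by
      have e : walk v (walkSum v f m) x - m * lam =
          walk v (fun y => walkSum v f m y - m * lam) x := by
        have hc : (Fintype.card ι : ℝ) ≠ 0 := by positivity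
        simp only [walk, sum_sub_distrib, sum_const, card_univ, nsmul_eq_mul, smul_eq_mul]
        field_simp
      rw [e]
      exact walk_mono (fun y => hle y m hm) x
    rw [hFn', walkSum_succ]
    push_cast
    linarith
  have hsum : ∑ x ∈ hE.toFinset, walk v F x ≤ ∑ x ∈ hE.toFinset, F x := by
    have h1 : ∀ i, ∑ x ∈ hE.toFinset, F (x + v i) ≤ ∑ x ∈ hE.toFinset, F x := by
      intro i
      rw [← sum_image (f := F) (g := fun x => x + v i) fun x _ y _ h => add_right_cancel h]
      rw [← sum_filter_add_sum_filter_not (s := hE.toFinset.image fun x => x + v i)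
        (p := fun y => y ∈ hE.toFinset), sum_eq_zero (s := filter (fun y => y ∉ hE.toFinset) _)
        fun y hy => hFE y (mem_filter.1 hy).2, add_zero]
      exact sum_le_sum_of_subset_of_nonneg (fun y hy => (mem_filter.1 hy).2) fun y _ _ => hF0 y
    simp only [walk]
    rw [← smul_sum, sum_comm, smul_eq_mul, inv_mul_le_iff₀ (by positivity)]
    calc _ ≤ ∑ _i : ι, ∑ x ∈ hE.toFinset, F x := sum_le_sum fun i _ => h1 i
      _ = _ := by rw [sum_const, card_univ, nsmul_eq_mul]
  have h2 := sum_le_sum key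
  rw [sum_add_distrib, sum_sub_distrib, sum_const, nsmul_eq_mul] at h2
  linarith

/-- The largest of the first `K + 1` ergodic averages. -/
noncomputable def maxAverage (v : ι → X) (f : X → ℝ) (K : ℕ) (x : X) : ℝ :=
  (range (K + 1)).sup' nonempty_range_add_one fun n => walkSum v f (n + 1) x / ((n + 1 : ℕ) : ℝ)

theorem maxAverage_nonneg {f : X → ℝ} (hf : ∀ x, 0 ≤ f x) (K : ℕ) (x : X) :
    0 ≤ maxAverage v f K x :=
  le_trans (div_nonneg (walkSum_nonneg hf _ x) (by positivity))
    (le_sup' (fun n : ℕ => walkSum v f (n + 1) x / ((n + 1 : ℕ) : ℝ)) (mem_range.2 K.succ_pos))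

theorem maxAverage_le_walkSum {f : X → ℝ} (hf : ∀ x, 0 ≤ f x) (K : ℕ) (x : X) :
    maxAverage v f K x ≤ walkSum v f (K + 1) x := by
  refine sup'_le _ _ fun n hn => ?_
  refine (div_le_self (walkSum_nonneg hf _ x) (by exact_mod_cast Nat.succ_pos n)).trans ?_
  exact sum_le_sum_of_subset_of_nonneg (range_subset_range.2 (by have := mem_range.1 hn; omega))
    fun k _ _ => iterate_walk_nonneg hf k x

theorem lt_maxAverage_iff {f : X → ℝ} {K : ℕ} {x : X} {lam : ℝ} :
    lam < maxAverage v f K x ↔ ∃ n ≤ K + 1, n * lam < walkSum v f n x := by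
  rw [maxAverage, lt_sup'_iff]
  constructor
  · rintro ⟨n, hn, h⟩
    rw [lt_div_iff₀ (by positivity)] at h
    exact ⟨n + 1, by have := mem_range.1 hn; omega, by linarith⟩
  · rintro ⟨n, hn, h⟩
    obtain ⟨m, rfl⟩ : ∃ m, n = m + 1 := by
      refine Nat.exists_eq_succ_of_ne_zero ?_
      rintro rfl
      simp [walkSum] at h
    refine ⟨m, mem_range.2 (by omega), ?_⟩
    rw [lt_div_iff₀ (by positivity)]
    linarith

variable [Countable X] [MeasurableSpace X] [MeasurableSingletonClass X]

theorem lintegral_ofReal_sq_lt_top {f : X → ℝ} (hf : Summable fun x => f x ^ 2) :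
    ∫⁻ x, ENNReal.ofReal (f x ^ 2) ∂Measure.count < ∞ := by
  rw [lintegral_count]
  exact hf.tsum_ofReal_lt_top

/-- The weak type inequality `lam * #{M > lam} ≤ ∑_{M > lam} f` implies the strong type `(2, 2)`
inequality on integrating over `lam`. -/
theorem lintegral_sq_maxAverage_le [Nonempty ι] {f : X → ℝ} (hf0 : ∀ x, 0 ≤ f x)
    (hf : Summable fun x => f x ^ 2) (K : ℕ) :
    ∫⁻ x, ENNReal.ofReal (maxAverage v f K x ^ 2) ∂Measure.count ≤
      4 * ∫⁻ x, ENNReal.ofReal (f x ^ 2) ∂Measure.count := by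
  set M := maxAverage v f K with hM
  have hM0 : ∀ x, 0 ≤ M x := maxAverage_nonneg hf0 K
  set ν : Measure X := Measure.count.withDensity fun x => ENNReal.ofReal (f x) with hν
  have hmeas : ∀ g : X → ℝ, Measurable g := fun g => measurable_of_countable g
  have hfin : ∫⁻ x, ENNReal.ofReal (M x ^ 2) ∂Measure.count < ∞ := by
    refine lintegral_ofReal_sq_lt_top ((summable_sq_walkSum (v := v) hf (K + 1)).of_nonneg_of_le
      (fun x => sq_nonneg _) fun x => ?_)
    exact pow_le_pow_left₀ (hM0 x) (maxAverage_le_walkSum hf0 K x) 2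
  have hweak : ∀ t : ℝ, 0 < t → Measure.count {x | t < M x} * ENNReal.ofReal t ≤ ν {x | t < M x} := by
    intro t ht
    have hE := finite_exceedance (v := v) hf ht (K + 1)
    have e : {x | t < M x} = ↑hE.toFinset := by
      ext x
      simp only [Set.Finite.coe_toFinset, Set.mem_ofPred_eq]
      exact lt_maxAverage_iff
    rw [e, hν, withDensity_apply _ (Finset.measurableSet _), Measure.count_apply_finset,
      lintegral_finset]
    simp only [Measure.count_singleton, mul_one]
    rw [← ENNReal.ofReal_sum_of_nonneg fun x _ => hf0 x, ← ENNReal.ofReal_natCast,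
      ← ENNReal.ofReal_mul (Nat.cast_nonneg _), mul_comm]
    exact ENNReal.ofReal_le_ofReal (mul_card_exceedance_le hE)
  have h1 := lintegral_rpow_eq_lintegral_meas_lt_mul (Measure.count : Measure X)
    (Filter.Eventually.of_forall hM0) (hmeas M).aemeasurable (p := 2) (by norm_num)
  have h2 := lintegral_eq_lintegral_meas_lt ν (Filter.Eventually.of_forall hM0)
    (hmeas M).aemeasurable
  simp only [Real.rpow_two] at h1
  have h3 : ∫⁻ x, ENNReal.ofReal (M x ^ 2) ∂Measure.count ≤
      2 * ∫⁻ x, ENNReal.ofReal (M x) ∂ν := by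
    rw [h1, h2]
    rw [show ENNReal.ofReal 2 = 2 by simp]
    gcongr 2 * ?_
    refine setLIntegral_mono' measurableSet_Ioi fun t ht => ?_
    rw [show (2 : ℝ) - 1 = 1 by norm_num, Real.rpow_one]
    exact hweak t ht
  have h4 : 2 * ∫⁻ x, ENNReal.ofReal (M x) ∂ν ≤
      2 * ∫⁻ x, ENNReal.ofReal (f x ^ 2) ∂Measure.count +
        2⁻¹ * ∫⁻ x, ENNReal.ofReal (M x ^ 2) ∂Measure.count := by
    rw [hν, lintegral_withDensity_eq_lintegral_mul _ (hmeas f).ennreal_ofReal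
      (hmeas M).ennreal_ofReal, ← lintegral_const_mul _ (by fun_prop),
      ← lintegral_const_mul _ (by fun_prop), ← lintegral_const_mul _ (by fun_prop),
      ← lintegral_add_left (by fun_prop)]
    refine lintegral_mono fun x => ?_
    simp only [Pi.mul_apply]
    rw [← ENNReal.ofReal_mul (hf0 x), show (2 : ℝ≥0∞) = ENNReal.ofReal 2 by simp,
      ← ENNReal.ofReal_inv_of_pos two_pos, ← ENNReal.ofReal_mul two_pos.le,
      ← ENNReal.ofReal_mul two_pos.le, ← ENNReal.ofReal_mul (by norm_num),
      ← ENNReal.ofReal_add (by positivity) (by positivity)]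
    refine ENNReal.ofReal_le_ofReal ?_
    nlinarith [sq_nonneg (2 * f x - M x)]
  set a := ∫⁻ x, ENNReal.ofReal (M x ^ 2) ∂Measure.count
  set b := ∫⁻ x, ENNReal.ofReal (f x ^ 2) ∂Measure.count
  have hb : b < ∞ := lintegral_ofReal_sq_lt_top hf
  lift a to NNReal using hfin.ne with a'
  lift b to NNReal using hb.ne with b'
  have h5 := h3.trans h4
  rw [show (2⁻¹ : ℝ≥0∞) = ((2⁻¹ : NNReal) : ℝ≥0∞) by simp] at h5
  have h6 : a' ≤ 2 * b' + 2⁻¹ * a' := by exact_mod_cast h5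
  have h7 : a' ≤ 4 * b' := by
    rw [← NNReal.coe_le_coe] at h6 ⊢
    push_cast at h6 ⊢
    linarith
  exact_mod_cast h7

/-- The maximal function of the ergodic averages is bounded on `ℓ²` with a norm at most `2`, whatever
the random walk. -/
theorem lintegral_sq_iSup_average_le [Nonempty ι] {h : X → E} (hh : Summable fun x => ‖h x‖ ^ 2) :
    ∫⁻ x, (⨆ n : ℕ, ‖(((n + 1 : ℕ) : ℝ))⁻¹ • walkSum v h (n + 1) x‖ₑ) ^ 2 ∂Measure.count ≤
      4 * ∫⁻ x, ‖h x‖ₑ ^ 2 ∂Measure.count := by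
  set f : X → ℝ := fun x => ‖h x‖ with hf
  have hf0 : ∀ x, 0 ≤ f x := fun x => norm_nonneg _
  have h1 : ∀ x, (⨆ n : ℕ, ‖(((n + 1 : ℕ) : ℝ))⁻¹ • walkSum v h (n + 1) x‖ₑ) ^ 2 ≤
      ⨆ K : ℕ, ENNReal.ofReal (maxAverage v f K x ^ 2) := by
    intro x
    rw [ENNReal.iSup_pow]
    refine iSup_mono fun n => ?_
    rw [← ofReal_norm, ← ENNReal.ofReal_pow (norm_nonneg _)]
    refine ENNReal.ofReal_le_ofReal (pow_le_pow_left₀ (norm_nonneg _) ?_ 2)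
    refine le_trans ?_ (le_sup' (fun n : ℕ => walkSum v f (n + 1) x / ((n + 1 : ℕ) : ℝ))
      (mem_range.2 n.lt_succ_self))
    rw [norm_smul, norm_inv, Real.norm_of_nonneg (by positivity), div_eq_inv_mul]
    gcongr
    exact norm_walkSum_le h _ x
  refine (lintegral_mono h1).trans ?_
  rw [lintegral_iSup (fun K => measurable_of_countable _)]
  · refine iSup_le fun K => (lintegral_sq_maxAverage_le hf0 hh K).trans (le_of_eq ?_)
    congr 2
    funext x
    rw [← ofReal_norm, ← ENNReal.ofReal_pow (norm_nonneg _)]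
  · intro K L hKL x
    refine ENNReal.ofReal_le_ofReal (pow_le_pow_left₀ (maxAverage_nonneg hf0 K x) ?_ 2)
    exact sup'_mono _ (range_subset_range.2 (by omega)) _

end RandomWalk

/-! ### Comparison of the multipliers -/

namespace SphericalMaximal

open Finset

/-- The multiplier of the `N`-th ergodic average of a self-adjoint Markov operator, as a function of
the multiplier `c` of the operator. -/
noncomputable def averageMultiplier (N : ℕ) (c : ℝ) : ℝ := (N : ℝ)⁻¹ * ∑ k ∈ range N, c ^ k

theorem one_sub_pow_le {u : ℝ} (hu0 : 0 ≤ u) (hu1 : u ≤ 1) (k : ℕ) :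
    |1 - (1 - 2 * u) ^ k| ≤ k * (2 * u) := by
  have hc : |1 - 2 * u| ≤ 1 := abs_le.2 ⟨by linarith, by linarith⟩
  induction k with
  | zero => simp
  | succ k ih =>
    have e : 1 - (1 - 2 * u) ^ (k + 1) = (1 - (1 - 2 * u) ^ k) + (1 - 2 * u) ^ k * (2 * u) := by ring
    rw [e]
    refine (abs_add_le _ _).trans ?_
    rw [abs_mul, abs_pow, abs_of_nonneg (by linarith : 0 ≤ 2 * u)]
    have := pow_le_one₀ (n := k) (abs_nonneg _) hc
    push_cast
    nlinarith

theorem abs_one_sub_averageMultiplier_le {u : ℝ} (hu0 : 0 ≤ u) (hu1 : u ≤ 1) {N : ℕ} (hN : 0 < N) :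
    |1 - averageMultiplier N (1 - 2 * u)| ≤ ((N : ℝ) - 1) * (2 * u) := by
  have hN' : (0 : ℝ) < N := by exact_mod_cast hN
  have e : 1 - averageMultiplier N (1 - 2 * u) =
      (N : ℝ)⁻¹ * ∑ k ∈ range N, (1 - (1 - 2 * u) ^ k) := by
    rw [averageMultiplier, sum_sub_distrib, sum_const, card_range, nsmul_eq_mul]
    field_simp
  rw [e, abs_mul, abs_of_pos (inv_pos.2 hN'), inv_mul_le_iff₀ hN']
  refine (abs_sum_le_sum_abs _ _).trans ?_
  calc _ ≤ ∑ _k ∈ range N, ((N : ℝ) - 1) * (2 * u) := by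
        refine sum_le_sum fun k hk => (one_sub_pow_le hu0 hu1 k).trans ?_
        have : ((k + 1 : ℕ) : ℝ) ≤ N := by exact_mod_cast mem_range.1 hk
        push_cast at this
        gcongr
        linarith
    _ = _ := by rw [sum_const, card_range, nsmul_eq_mul]

theorem abs_averageMultiplier_le {u : ℝ} (hu0 : 0 < u) (hu1 : u ≤ 1) {N : ℕ} (hN : 0 < N) :
    |averageMultiplier N (1 - 2 * u)| ≤ 1 / (N * u) := by
  have hN' : (0 : ℝ) < N := by exact_mod_cast hN
  have hc : |1 - 2 * u| ≤ 1 := abs_le.2 ⟨by linarith, by linarith⟩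
  have h := geom_sum_mul_neg (1 - 2 * u) N
  have h1 : |1 - (1 - 2 * u) ^ N| ≤ 2 := by
    refine (abs_sub _ _).trans ?_
    rw [abs_one, abs_pow]
    have := pow_le_one₀ (n := N) (abs_nonneg _) hc
    linarith
  rw [← h, abs_mul, show 1 - (1 - 2 * u) = 2 * u by ring, abs_of_pos (by linarith : 0 < 2 * u)] at h1
  rw [averageMultiplier, abs_mul, abs_of_pos (inv_pos.2 hN'), le_div_iff₀ (by positivity)]
  calc _ = |∑ k ∈ range N, (1 - 2 * u) ^ k| * u := by field_simp
    _ ≤ 1 := by linarith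

theorem four_mul_sq_le_sin_sq {x : ℝ} (hx : |x| ≤ 1 / 2) : 4 * x ^ 2 ≤ Real.sin (Real.pi * x) ^ 2 := by
  have hpi := Real.pi_pos
  have h := Real.mul_le_sin (x := Real.pi * |x|) (by positivity) (by nlinarith)
  have e : 2 / Real.pi * (Real.pi * |x|) = 2 * |x| := by field_simp
  rw [e] at h
  have e2 : Real.sin (Real.pi * |x|) ^ 2 = Real.sin (Real.pi * x) ^ 2 := by
    rcases abs_choice x with hx | hx <;> rw [hx]
    rw [mul_neg, Real.sin_neg, neg_sq]
  rw [← e2, ← sq_abs x]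
  nlinarith [abs_nonneg x]

theorem sin_sq_le (x : ℝ) : Real.sin (Real.pi * x) ^ 2 ≤ Real.pi ^ 2 * x ^ 2 := by
  rw [← mul_pow, ← sq_abs, ← sq_abs (Real.pi * x)]
  exact pow_le_pow_left₀ (abs_nonneg _) Real.abs_sin_le_abs 2

variable {d : ℕ}

/-- The mean of `sin² (π w j)` over the coordinates `j`; the simple random walk has the multiplier
`1 - 2 * meanSinSq`. -/
noncomputable def meanSinSq (w : EuclideanSpace ℝ (Fin d)) : ℝ :=
  (d : ℝ)⁻¹ * ∑ j, Real.sin (Real.pi * w j) ^ 2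

theorem meanSinSq_nonneg (w : EuclideanSpace ℝ (Fin d)) : 0 ≤ meanSinSq w :=
  mul_nonneg (by positivity) (sum_nonneg fun _ _ => sq_nonneg _)

theorem meanSinSq_le_one (hd : 0 < d) (w : EuclideanSpace ℝ (Fin d)) : meanSinSq w ≤ 1 := by
  have hd' : (0 : ℝ) < d := by exact_mod_cast hd
  rw [meanSinSq, inv_mul_le_iff₀ hd', mul_one]
  calc _ ≤ ∑ _j : Fin d, (1 : ℝ) := sum_le_sum fun j _ => Real.sin_sq_le_one _
    _ = d := by simp

theorem four_mul_norm_sq_div_le {w : EuclideanSpace ℝ (Fin d)} (hw : ∀ j, |w j| ≤ 1 / 2) :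
    4 * (‖w‖ ^ 2 / d) ≤ meanSinSq w := by
  rw [EuclideanSpace.norm_sq_eq, meanSinSq, ← mul_div_assoc, div_eq_inv_mul]
  gcongr
  rw [mul_sum]
  refine sum_le_sum fun j _ => ?_
  rw [Real.norm_eq_abs, sq_abs]
  exact four_mul_sq_le_sin_sq (hw j)

theorem meanSinSq_le (w : EuclideanSpace ℝ (Fin d)) :
    meanSinSq w ≤ Real.pi ^ 2 * (‖w‖ ^ 2 / d) := by
  rw [EuclideanSpace.norm_sq_eq, meanSinSq, ← mul_div_assoc, div_eq_inv_mul]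
  gcongr
  rw [mul_sum]
  refine sum_le_sum fun j _ => ?_
  rw [Real.norm_eq_abs, sq_abs]
  exact sin_sq_le _

/-- The difference between the normalized multiplier of the sphere of radius `s` and that of the
ergodic average of length about `s²`. -/
noncomputable def multiplierDiff (s : ℝ) (w : EuclideanSpace ℝ (Fin d)) : ℂ :=
  ((sphereArea d)⁻¹ : ℂ) * sphereFourier (s • w) -
    (averageMultiplier ⌈s ^ 2⌉₊ (1 - 2 * meanSinSq w) : ℝ)

/-- Small scales: both multipliers are close to one. -/
theorem norm_multiplierDiff_le_mul (hd : 6 ≤ d) {s : ℝ} (hs : 0 < s)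
    {w : EuclideanSpace ℝ (Fin d)} (hw : ∀ j, |w j| ≤ 1 / 2) :
    ‖multiplierDiff s w‖ ≤ 32 * (s ^ 2 * meanSinSq w) := by
  have hσ := sphereArea_pos (show 0 < d by omega)
  have hu0 := meanSinSq_nonneg w
  have hu1 := meanSinSq_le_one (show 0 < d by omega) w
  have hN : 0 < ⌈s ^ 2⌉₊ := Nat.ceil_pos.2 (by positivity)
  have hN2 : (⌈s ^ 2⌉₊ : ℝ) < s ^ 2 + 1 := Nat.ceil_lt_add_one (by positivity)
  have e : multiplierDiff s w = ((sphereArea d)⁻¹ : ℂ) * (sphereFourier (s • w) - sphereArea d) +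
      ((1 - averageMultiplier ⌈s ^ 2⌉₊ (1 - 2 * meanSinSq w) : ℝ) : ℂ) := by
    have : (sphereArea d : ℂ) ≠ 0 := by exact_mod_cast hσ.ne'
    rw [multiplierDiff, mul_sub, inv_mul_cancel₀ this]
    push_cast
    ring
  have h1 : ‖((sphereArea d)⁻¹ : ℂ) * (sphereFourier (s • w) - sphereArea d)‖ ≤
      120 * (‖s • w‖ ^ 2 / d) := by
    rw [norm_mul, norm_inv, Complex.norm_of_nonneg hσ.le, inv_mul_le_iff₀ hσ, mul_comm]
    exact norm_sphereFourier_sub_le (by omega) _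
  have h2 := abs_one_sub_averageMultiplier_le hu0 hu1 hN
  rw [e]
  refine (norm_add_le _ _).trans ?_
  rw [Complex.norm_real, Real.norm_eq_abs]
  rw [norm_smul, Real.norm_of_nonneg hs.le, mul_pow] at h1
  have h3 := four_mul_norm_sq_div_le hw
  have h4 : s ^ 2 * (4 * (‖w‖ ^ 2 / d)) ≤ s ^ 2 * meanSinSq w := by gcongr
  have h5 : ((⌈s ^ 2⌉₊ : ℝ) - 1) * (2 * meanSinSq w) ≤ s ^ 2 * (2 * meanSinSq w) := by
    gcongr; linarith
  have h6 : s ^ 2 * ‖w‖ ^ 2 / d = s ^ 2 * (‖w‖ ^ 2 / d) := by ring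
  rw [h6] at h1
  linarith

/-- Large scales: both multipliers are small. -/
theorem norm_multiplierDiff_sq_le (hd : 6 ≤ d) {s : ℝ} (hs : 0 < s)
    {w : EuclideanSpace ℝ (Fin d)} (h1 : 1 ≤ s ^ 2 * meanSinSq w) :
    ‖multiplierDiff s w‖ ^ 2 ≤ 25 / (s ^ 2 * meanSinSq w) := by
  have hd' : (0 : ℝ) < d := by exact_mod_cast (show 0 < d by omega)
  have hσ := sphereArea_pos (show 0 < d by omega)
  set u := meanSinSq w with hu
  have hu0 : 0 < u := by
    refine lt_of_le_of_ne (meanSinSq_nonneg w) fun h => ?_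
    rw [← h, mul_zero] at h1
    linarith
  have hu1 : u ≤ 1 := meanSinSq_le_one (show 0 < d by omega) w
  set Y := s ^ 2 * u with hY
  have hY0 : 0 < Y := by linarith
  have hr : 1 ≤ √Y := Real.one_le_sqrt.2 h1
  have hrr : √Y * √Y = Y := Real.mul_self_sqrt hY0.le
  have hN : 0 < ⌈s ^ 2⌉₊ := Nat.ceil_pos.2 (by positivity)
  have hN1 : s ^ 2 ≤ (⌈s ^ 2⌉₊ : ℝ) := Nat.le_ceil _
  -- the bound `√Y ≤ π s ‖w‖ / √d`
  have hw : √Y * √d ≤ Real.pi * (s * ‖w‖) := by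
    rw [← Real.sqrt_mul hY0.le]
    refine Real.sqrt_le_iff.2 ⟨by positivity, ?_⟩
    have h2 := meanSinSq_le w
    rw [← hu, ← mul_div_assoc, le_div_iff₀ hd'] at h2
    calc Y * d = s ^ 2 * (u * d) := by rw [hY]; ring
      _ ≤ s ^ 2 * (Real.pi ^ 2 * ‖w‖ ^ 2) := by gcongr
      _ = _ := by ring
  have hF : √Y * ‖((sphereArea d)⁻¹ : ℂ) * sphereFourier (s • w)‖ ≤ 4 := by
    have h3 := norm_mul_norm_sphereFourier_le hd (s • w)
    rw [norm_smul, Real.norm_of_nonneg hs.le] at h3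
    rw [norm_mul, norm_inv, Complex.norm_of_nonneg hσ.le]
    have hsd : 0 < √(d : ℝ) := Real.sqrt_pos.2 hd'
    have h4 : √Y * ‖sphereFourier (s • w)‖ * √d ≤ 4 * sphereArea d * √d := by
      calc √Y * ‖sphereFourier (s • w)‖ * √d = √Y * √d * ‖sphereFourier (s • w)‖ := by ring
        _ ≤ Real.pi * (s * ‖w‖) * ‖sphereFourier (s • w)‖ := by gcongr
        _ = Real.pi * (s * ‖w‖ * ‖sphereFourier (s • w)‖) := by ring
        _ ≤ 4 * (√d * sphereArea d) := by gcongr; exact Real.pi_le_four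
        _ = _ := by ring
    have h5 := le_of_mul_le_mul_right h4 hsd
    calc _ = (sphereArea d)⁻¹ * (√Y * ‖sphereFourier (s • w)‖) := by ring
      _ ≤ 4 := by rw [inv_mul_le_iff₀ hσ]; linarith
  have hA : √Y * |averageMultiplier ⌈s ^ 2⌉₊ (1 - 2 * u)| ≤ 1 := by
    have h6 := abs_averageMultiplier_le hu0 hu1 hN
    have h7 : 1 / ((⌈s ^ 2⌉₊ : ℝ) * u) ≤ 1 / Y := by
      apply one_div_le_one_div_of_le hY0
      rw [hY]; gcongr
    have h8 : √Y ≤ Y := by nlinarith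
    calc _ ≤ √Y * (1 / Y) := by gcongr; exact h6.trans h7
      _ ≤ Y * (1 / Y) := by gcongr
      _ = 1 := by field_simp
  have h9 : √Y * ‖multiplierDiff s w‖ ≤ 5 := by
    have : ‖multiplierDiff s w‖ ≤ ‖((sphereArea d)⁻¹ : ℂ) * sphereFourier (s • w)‖ +
        |averageMultiplier ⌈s ^ 2⌉₊ (1 - 2 * u)| := by
      refine (norm_sub_le _ _).trans (le_of_eq ?_)
      rw [Complex.norm_real, Real.norm_eq_abs]
    nlinarith [Real.sqrt_nonneg Y]
  rw [le_div_iff₀ hY0, ← hrr]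
  have : 0 ≤ √Y * ‖multiplierDiff s w‖ := by positivity
  nlinarith

/-- The bound of the square of the difference by a multiple of `min Y Y⁻¹`, `Y = s² u`, in a form
that telescopes when `s` runs over a dyadic sequence. -/
theorem norm_multiplierDiff_sq_le_telescope (hd : 6 ≤ d) {s : ℝ} (hs : 0 < s)
    {w : EuclideanSpace ℝ (Fin d)} (hw : ∀ j, |w j| ≤ 1 / 2) {Y : ℝ} (hY : Y = s ^ 2 * meanSinSq w) :
    ‖multiplierDiff s w‖ ^ 2 ≤ 3500 * (4 * Y / (1 + 4 * Y) - Y / (1 + Y)) := by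
  have hY0 : 0 ≤ Y := hY ▸ mul_nonneg (sq_nonneg _) (meanSinSq_nonneg w)
  have e : 4 * Y / (1 + 4 * Y) - Y / (1 + Y) = 3 * Y / ((1 + 4 * Y) * (1 + Y)) := by
    field_simp
    ring
  rw [e, ← mul_div_assoc, le_div_iff₀ (by positivity)]
  rcases le_or_gt Y 1 with h | h
  · have h1 := norm_multiplierDiff_le_mul hd hs hw
    rw [← hY] at h1
    have h2 : ‖multiplierDiff s w‖ ^ 2 ≤ 1024 * Y := by nlinarith [norm_nonneg (multiplierDiff s w)]
    calc _ ≤ 1024 * Y * ((1 + 4 * 1) * (1 + 1)) := by gcongr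
      _ ≤ _ := by linarith
  · have h1 := norm_multiplierDiff_sq_le hd hs (w := w) (by rw [← hY]; exact h.le)
    rw [← hY] at h1
    calc _ ≤ 25 / Y * ((Y + 4 * Y) * (Y + Y)) := by gcongr
      _ = 250 * Y := by field_simp; ring
      _ ≤ _ := by linarith

/-- The square function of the differences over all dyadic radii is bounded pointwise. -/
theorem tsum_multiplierDiff_le (hd : 6 ≤ d) {r : ℝ} (hr : 0 < r)
    {w : EuclideanSpace ℝ (Fin d)} (hw : ∀ j, |w j| ≤ 1 / 2) :
    ∑' n : ℕ, ‖multiplierDiff (2 ^ n * r) w‖ₑ ^ 2 ≤ 3500 := by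
  refine ENNReal.tsum_le_of_sum_range_le fun N => ?_
  set Y₀ := r ^ 2 * meanSinSq w with hY₀
  have hY0 : 0 ≤ Y₀ := mul_nonneg (sq_nonneg _) (meanSinSq_nonneg w)
  let φ : ℕ → ℝ := fun n => 4 ^ n * Y₀ / (1 + 4 ^ n * Y₀)
  have h1 : ∀ n : ℕ, ‖multiplierDiff (2 ^ n * r) w‖ ^ 2 ≤ 3500 * (φ (n + 1) - φ n) := by
    intro n
    have := norm_multiplierDiff_sq_le_telescope hd (s := 2 ^ n * r) (by positivity) hw
      (Y := 4 ^ n * Y₀) (by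
        rw [hY₀, mul_pow, ← pow_mul, mul_comm n 2, pow_mul]; norm_num; ring)
    simp only [φ, pow_succ' (4 : ℝ)]
    rwa [← mul_assoc] at this
  have h2 : ∑ n ∈ range N, ‖multiplierDiff (2 ^ n * r) w‖ ^ 2 ≤ 3500 := by
    refine (sum_le_sum fun n _ => h1 n).trans ?_
    rw [← mul_sum, sum_range_sub]
    have h3 : φ N ≤ 1 := by
      simp only [φ]
      rw [div_le_one (by positivity)]
      linarith
    have h4 : 0 ≤ φ 0 := by simp only [φ]; positivity
    linarith
  calc ∑ n ∈ range N, ‖multiplierDiff (2 ^ n * r) w‖ₑ ^ 2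
      = ENNReal.ofReal (∑ n ∈ range N, ‖multiplierDiff (2 ^ n * r) w‖ ^ 2) := by
        rw [ENNReal.ofReal_sum_of_nonneg fun n _ => by positivity]
        refine sum_congr rfl fun n _ => ?_
        rw [← ofReal_norm, ENNReal.ofReal_pow (norm_nonneg _)]
    _ ≤ ENNReal.ofReal 3500 := ENNReal.ofReal_le_ofReal h2
    _ = 3500 := by simp

theorem abs_averageMultiplier_le_one (N : ℕ) {c : ℝ} (hc : |c| ≤ 1) : |averageMultiplier N c| ≤ 1 := by
  rw [averageMultiplier, abs_mul, abs_of_nonneg (by positivity)]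
  rcases N.eq_zero_or_pos with rfl | hN
  · simp
  have hN' : (0 : ℝ) < N := by exact_mod_cast hN
  rw [inv_mul_le_iff₀ hN', mul_one]
  refine (abs_sum_le_sum_abs _ _).trans ?_
  calc _ ≤ ∑ _k ∈ range N, (1 : ℝ) :=
        sum_le_sum fun k _ => by rw [abs_pow]; exact pow_le_one₀ (abs_nonneg _) hc
    _ = N := by simp

theorem norm_inv_mul_sphereFourier_le (hd : 0 < d) (η : EuclideanSpace ℝ (Fin d)) :
    ‖((sphereArea d)⁻¹ : ℂ) * sphereFourier η‖ ≤ 1 := by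
  have hσ := sphereArea_pos hd
  rw [norm_mul, norm_inv, Complex.norm_of_nonneg hσ.le, inv_mul_le_iff₀ hσ, mul_one]
  exact norm_sphereFourier_le η

end SphericalMaximal

/-! ### Multipliers on the torus -/

namespace SphericalMaximal

open Finset

variable {d : ℕ}

/-- The inverse Fourier transform `x ↦ ∫ g(ξ) e^{2πi x·ξ} dξ` of a function on the torus. -/
noncomputable def invFourier (g : UnitAddTorus (Fin d) → ℂ) (x : Fin d → ℤ) : ℂ :=
  ∫ ξ, g ξ * UnitAddTorus.mFourier x ξ ∂torusMeasure d

/-- Plancherel's theorem on the torus. -/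
theorem lintegral_invFourier_sq {g : UnitAddTorus (Fin d) → ℂ} (hg : MemLp g 2 (torusMeasure d)) :
    ∫⁻ x, ‖invFourier g x‖ₑ ^ 2 ∂Measure.count = ∫⁻ ξ, ‖g ξ‖ₑ ^ 2 ∂torusMeasure d := by
  have h := UnitAddTorus.hasSum_sq_mFourierCoeff (hg.toLp g)
  have e1 : ∀ i : Fin d → ℤ, UnitAddTorus.mFourierCoeff (hg.toLp g) i = invFourier g (-i) := by
    intro i
    refine integral_congr_ae ?_
    filter_upwards [hg.coeFn_toLp] with t ht
    rw [ht, smul_eq_mul, mul_comm]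
  have e2 : ∫ t, ‖hg.toLp g t‖ ^ 2 ∂torusMeasure d = ∫ t, ‖g t‖ ^ 2 ∂torusMeasure d := by
    refine integral_congr_ae ?_
    filter_upwards [hg.coeFn_toLp] with t ht
    rw [ht]
  have h' : HasSum (fun i : Fin d → ℤ => ‖invFourier g (-i)‖ ^ 2)
      (∫ t, ‖g t‖ ^ 2 ∂torusMeasure d) := by
    rw [← e2]
    simp only [← e1]
    exact h
  have h2 : HasSum (fun i : Fin d → ℤ => ‖invFourier g i‖ ^ 2) (∫ t, ‖g t‖ ^ 2 ∂torusMeasure d) :=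
    (Equiv.neg (Fin d → ℤ)).hasSum_iff.1 h'
  have e3 : ∀ z : ℂ, ‖z‖ₑ ^ 2 = ENNReal.ofReal (‖z‖ ^ 2) := fun z => by
    rw [← ofReal_norm, ENNReal.ofReal_pow (norm_nonneg _)]
  simp only [e3]
  rw [lintegral_count, ← ENNReal.ofReal_tsum_of_nonneg (fun _ => by positivity) h2.summable,
    h2.tsum_eq, ofReal_integral_eq_lintegral_ofReal
      ((memLp_two_iff_integrable_sq_norm hg.1).1 hg)
      (Filter.Eventually.of_forall fun _ => by positivity)]

theorem lintegral_fourierL2_sq (f : lp (fun _ : Fin d → ℤ => ℂ) 2) :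
    ∫⁻ ξ, ‖fourierL2 f ξ‖ₑ ^ 2 ∂torusMeasure d = ENNReal.ofReal (‖f‖ ^ 2) := by
  have hg : Memℓp (fun x : Fin d → ℤ => f (-x)) 2 := by
    have h2 : (0 : ℝ) < (2 : ℝ≥0∞).toReal := by norm_num
    have h := (memℓp_gen_iff h2).1 (lp.memℓp f)
    exact (memℓp_gen_iff h2).2 ((Equiv.neg (Fin d → ℤ)).summable_iff.2 h)
  have h := (UnitAddTorus.mFourierBasis (d := Fin d)).hasSum_repr_symm ⟨_, hg⟩
  have h' := (Equiv.neg (Fin d → ℤ)).hasSum_iff.2 h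
  have e : ((fun i : Fin d → ℤ => f (-i) • (UnitAddTorus.mFourierBasis (d := Fin d)) i) ∘
      Equiv.neg (Fin d → ℤ)) = fun x => f x • characterL2 x := by
    funext x
    simp only [Function.comp_apply, Equiv.neg_apply, neg_neg, UnitAddTorus.coe_mFourierBasis]
    rfl
  have h'' : HasSum (fun x : Fin d → ℤ => f x • characterL2 x) _ := e ▸ h'
  have hF : fourierL2 f = (UnitAddTorus.mFourierBasis (d := Fin d)).repr.symm ⟨_, hg⟩ :=
    (hasSum_fourierL2 f).unique h''
  have hn : ‖fourierL2 f‖ = ‖f‖ := by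
    rw [hF]
    refine ((UnitAddTorus.mFourierBasis (d := Fin d)).repr.symm.norm_map _).trans ?_
    have h2 : (0 : ℝ) < (2 : ℝ≥0∞).toReal := by norm_num
    rw [lp.norm_eq_tsum_rpow h2, lp.norm_eq_tsum_rpow h2]
    congr 1
    exact (Equiv.neg (Fin d → ℤ)).tsum_eq fun x => ‖f x‖ ^ (2 : ℝ≥0∞).toReal
  rw [← hn, ENNReal.ofReal_pow (norm_nonneg _), ofReal_norm, Lp.enorm_def,
    eLpNorm_eq_lintegral_rpow_enorm_toReal two_ne_zero ENNReal.ofNat_ne_top, ← ENNReal.rpow_natCast,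
    ← ENNReal.rpow_mul]
  norm_num

theorem memLp_fourierL2 (f : lp (fun _ : Fin d → ℤ => ℂ) 2) :
    MemLp (fourierL2 f) 2 (torusMeasure d) := Lp.memLp _

theorem measurable_cubeRep : Measurable (cubeRep (d := d)) := by
  have h : Measurable fun (ξ : UnitAddTorus (Fin d)) (j : Fin d) =>
      (AddCircle.equivIco (1 : ℝ) (-1 / 2) (ξ j) : ℝ) := by
    refine measurable_pi_lambda _ fun j => ?_
    have h1 : Measurable fun y : AddCircle (1 : ℝ) => (AddCircle.equivIco (1 : ℝ) (-1 / 2) y : ℝ) :=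
      measurable_subtype_coe.comp (AddCircle.measurableEquivIco (1 : ℝ) (-1 / 2)).measurable
    exact h1.comp (measurable_pi_apply j)
  exact (MeasurableEquiv.toLp 2 (Fin d → ℝ)).measurable.comp h

theorem measurable_nearestInt : Measurable (nearestInt (d := d)) := by
  refine measurable_pi_lambda _ fun j => ?_
  have : Measurable fun x : EuclideanSpace ℝ (Fin d) => x j + 1 / 2 := by fun_prop
  exact this.floor

/-- The integer vector `⌊q ξ⌉`. -/
noncomputable def gridPoint (q : ℕ) (ξ : UnitAddTorus (Fin d)) : Fin d → ℤ :=
  nearestInt ((q : ℝ) • cubeRep ξ)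

/-- The difference `⌊q ξ⌉ - q ξ`. -/
noncomputable def gridOffset (q : ℕ) (ξ : UnitAddTorus (Fin d)) : EuclideanSpace ℝ (Fin d) :=
  toReal (gridPoint q ξ) - (q : ℝ) • cubeRep ξ

theorem measurable_gridPoint (q : ℕ) : Measurable (gridPoint (d := d) q) :=
  measurable_nearestInt.comp (measurable_cubeRep.const_smul (q : ℝ))

theorem measurable_gridOffset (q : ℕ) : Measurable (gridOffset (d := d) q) :=
  ((measurable_of_countable toReal).comp (measurable_gridPoint q)).sub
    (measurable_cubeRep.const_smul (q : ℝ))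

theorem abs_gridOffset_le (q : ℕ) (ξ : UnitAddTorus (Fin d)) (j : Fin d) :
    |gridOffset q ξ j| ≤ 1 / 2 := by
  have h := (nearestInt_eq_iff ((q : ℝ) • cubeRep ξ) _).1 rfl j
  have e : gridOffset q ξ j = -((((q : ℝ) • cubeRep ξ) j) -
      (nearestInt ((q : ℝ) • cubeRep ξ) j : ℝ)) := by
    simp only [gridOffset, gridPoint, toReal, PiLp.sub_apply]
    ring
  rw [e, abs_neg, abs_le]
  exact ⟨by linarith [h.1], h.2.le⟩

theorem fourier_apply_eq (q : ℤ) (z : UnitAddCircle) {y : ℝ} (hy : (y : UnitAddCircle) = z) :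
    fourier q z = Complex.exp (2 * Real.pi * (q * y) * Complex.I) := by
  rw [← hy, fourier_coe_apply]
  congr 1
  push_cast
  ring

theorem fourier_add_fourier_neg (q : ℕ) (ξ : UnitAddTorus (Fin d)) (j : Fin d) :
    fourier (q : ℤ) (ξ j) + fourier (-(q : ℤ)) (ξ j) =
      ((2 * (1 - 2 * Real.sin (Real.pi * gridOffset q ξ j) ^ 2) : ℝ) : ℂ) := by
  have hy : ((cubeRep ξ j : ℝ) : UnitAddCircle) = ξ j := AddCircle.coe_equivIco
  have e : (q : ℝ) * cubeRep ξ j = gridPoint q ξ j - gridOffset q ξ j := by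
    simp [gridOffset, toReal]
  rw [fourier_apply_eq _ _ hy, fourier_apply_eq _ _ hy]
  have e1 : (2 * Real.pi * (((q : ℤ) : ℂ) * (cubeRep ξ j : ℝ)) * Complex.I : ℂ) =
      (((2 * Real.pi * (q * cubeRep ξ j) : ℝ)) : ℂ) * Complex.I := by push_cast; ring
  have e2 : (2 * Real.pi * (((-(q : ℤ) : ℤ) : ℂ) * (cubeRep ξ j : ℝ)) * Complex.I : ℂ) =
      -(((2 * Real.pi * (q * cubeRep ξ j) : ℝ)) : ℂ) * Complex.I := by push_cast; ring
  rw [e1, e2, ← Complex.two_cos, ← Complex.ofReal_cos, e]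
  have e3 : Real.cos (2 * Real.pi * ((gridPoint q ξ j : ℝ) - gridOffset q ξ j)) =
      1 - 2 * Real.sin (Real.pi * gridOffset q ξ j) ^ 2 := by
    rw [show 2 * Real.pi * ((gridPoint q ξ j : ℝ) - gridOffset q ξ j) =
      (gridPoint q ξ j : ℝ) * (2 * Real.pi) - 2 * (Real.pi * gridOffset q ξ j) by ring,
      Real.cos_int_mul_two_pi_sub, Real.cos_two_mul, Real.cos_sq']
    ring
  rw [e3]
  push_cast
  ring

/-- The steps `± q e_j` of the random walk on the sublattice `q ℤ^d`. -/
def gridStep (q : ℕ) (i : Fin d × Bool) : Fin d → ℤ :=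
  Pi.single i.1 (if i.2 then (q : ℤ) else -(q : ℤ))

theorem mFourier_pi_single (j : Fin d) (m : ℤ) (ξ : UnitAddTorus (Fin d)) :
    UnitAddTorus.mFourier (Pi.single j m) ξ = fourier m (ξ j) := by
  rw [UnitAddTorus.mFourier, ContinuousMap.coe_mk, prod_eq_single j]
  · rw [Pi.single_eq_same]
  · intro i _ hij
    rw [Pi.single_eq_of_ne hij, fourier_zero]
  · intro h
    exact absurd (mem_univ j) h

/-- The multiplier of the random walk with steps `± q e_j`. -/
noncomputable def walkMultiplier (q : ℕ) (ξ : UnitAddTorus (Fin d)) : ℝ :=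
  1 - 2 * meanSinSq (gridOffset q ξ)

theorem mean_mFourier_gridStep (hd : 0 < d) (q : ℕ) (ξ : UnitAddTorus (Fin d)) :
    (Fintype.card (Fin d × Bool) : ℝ)⁻¹ • ∑ i, UnitAddTorus.mFourier (gridStep q i) ξ =
      (walkMultiplier q ξ : ℂ) := by
  have hd' : (d : ℂ) ≠ 0 := by exact_mod_cast hd.ne'
  rw [Fintype.sum_prod_type]
  simp only [Fintype.sum_bool, gridStep, if_true, Bool.false_eq_true, if_false, mFourier_pi_single,
    fourier_add_fourier_neg]
  rw [← Complex.ofReal_sum, ← mul_sum, sum_sub_distrib, ← mul_sum, walkMultiplier, meanSinSq]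
  simp only [sum_const, card_univ, Fintype.card_prod, Fintype.card_fin, Fintype.card_bool,
    nsmul_eq_mul, mul_one, Complex.real_smul]
  push_cast
  field_simp

theorem abs_walkMultiplier_le (hd : 0 < d) (q : ℕ) (ξ : UnitAddTorus (Fin d)) :
    |walkMultiplier q ξ| ≤ 1 := by
  have h1 := meanSinSq_nonneg (gridOffset q ξ)
  have h2 := meanSinSq_le_one hd (gridOffset q ξ)
  exact abs_le.2 ⟨by unfold walkMultiplier; linarith, by unfold walkMultiplier; linarith⟩

theorem measurable_walkMultiplier (q : ℕ) : Measurable (walkMultiplier (d := d) q) := by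
  have h : Measurable (meanSinSq (d := d)) := by
    unfold meanSinSq
    fun_prop
  exact ((h.comp (measurable_gridOffset q)).const_mul 2).const_sub 1

theorem memLp_mul_of_bounded {m g : UnitAddTorus (Fin d) → ℂ} (hm : Measurable m)
    {C : ℝ} (hC : ∀ ξ, ‖m ξ‖ ≤ C) (hg : MemLp g 2 (torusMeasure d)) :
    MemLp (fun ξ => m ξ * g ξ) 2 (torusMeasure d) :=
  hg.of_le_mul (c := C) (hm.aestronglyMeasurable.mul hg.1) (Filter.Eventually.of_forall fun ξ => by
    rw [norm_mul]; exact mul_le_mul_of_nonneg_right (hC ξ) (norm_nonneg _))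

theorem integrable_mul_mFourier {g : UnitAddTorus (Fin d) → ℂ} (hg : MemLp g 2 (torusMeasure d))
    (x : Fin d → ℤ) : Integrable (fun ξ => g ξ * UnitAddTorus.mFourier x ξ) (torusMeasure d) := by
  refine (hg.integrable one_le_two).mul_bdd (c := 1)
    (UnitAddTorus.mFourier x).continuous.aestronglyMeasurable (Filter.Eventually.of_forall fun ξ => ?_)
  exact ((UnitAddTorus.mFourier x).norm_coe_le_norm ξ).trans_eq UnitAddTorus.mFourier_norm

open RandomWalk

theorem walk_invFourier (hd : 0 < d) (q : ℕ) {g : UnitAddTorus (Fin d) → ℂ}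
    (hg : MemLp g 2 (torusMeasure d)) :
    walk (gridStep q) (invFourier g) = invFourier fun ξ => (walkMultiplier q ξ : ℂ) * g ξ := by
  funext x
  simp only [walk, invFourier]
  rw [← integral_finsetSum _ fun i _ => integrable_mul_mFourier hg _, ← integral_smul]
  refine integral_congr_ae (Filter.Eventually.of_forall fun ξ => ?_)
  simp only [UnitAddTorus.mFourier_add, ← mean_mFourier_gridStep hd q ξ, Complex.real_smul]
  rw [← mul_sum, ← mul_sum]
  ring

theorem memLp_walkMultiplier_pow (hd : 0 < d) (q k : ℕ) {g : UnitAddTorus (Fin d) → ℂ}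
    (hg : MemLp g 2 (torusMeasure d)) :
    MemLp (fun ξ => (walkMultiplier q ξ : ℂ) ^ k * g ξ) 2 (torusMeasure d) :=
  memLp_mul_of_bounded (C := 1)
    ((Complex.measurable_ofReal.comp (measurable_walkMultiplier q)).pow_const k)
    (fun ξ => by
      rw [norm_pow, Complex.norm_real]
      exact pow_le_one₀ (norm_nonneg _) (abs_walkMultiplier_le hd q ξ)) hg

theorem iterate_walk_invFourier (hd : 0 < d) (q k : ℕ) {g : UnitAddTorus (Fin d) → ℂ}
    (hg : MemLp g 2 (torusMeasure d)) :
    (walk (gridStep q))^[k] (invFourier g) =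
      invFourier fun ξ => (walkMultiplier q ξ : ℂ) ^ k * g ξ := by
  induction k with
  | zero => simp
  | succ k ih =>
    rw [Function.iterate_succ_apply', ih, walk_invFourier hd q (memLp_walkMultiplier_pow hd q k hg)]
    congr 1
    funext ξ
    ring

theorem average_invFourier (hd : 0 < d) (q N : ℕ) {g : UnitAddTorus (Fin d) → ℂ}
    (hg : MemLp g 2 (torusMeasure d)) (x : Fin d → ℤ) :
    (N : ℝ)⁻¹ • walkSum (gridStep q) (invFourier g) N x =
      invFourier (fun ξ => (averageMultiplier N (walkMultiplier q ξ) : ℂ) * g ξ) x := by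
  simp only [walkSum, iterate_walk_invFourier hd q _ hg]
  simp only [invFourier]
  rw [← integral_finsetSum _ fun k _ =>
    integrable_mul_mFourier (memLp_walkMultiplier_pow hd q k hg) _, ← integral_smul]
  refine integral_congr_ae (Filter.Eventually.of_forall fun ξ => ?_)
  simp only [averageMultiplier, Complex.real_smul]
  push_cast
  rw [mul_assoc, mul_assoc, sum_mul]
  simp only [mul_assoc]

end SphericalMaximal

/-! ### The maximal inequality -/

namespace SphericalMaximal

open Finset

variable {d : ℕ}

theorem norm_gaussSum_le {p q : ℕ} (hq : 0 < q) (x : Fin d → ℤ) : ‖gaussSum p q x‖ ≤ 1 := by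
  have hq' : (0 : ℝ) < q := by exact_mod_cast hq
  rw [gaussSum, norm_mul, norm_inv, norm_pow, Complex.norm_natCast,
    inv_mul_le_iff₀ (by positivity), mul_one]
  refine (norm_sum_le _ _).trans ?_
  have h : ∀ n : Fin d → ℕ, ‖Complex.exp (2 * Real.pi * Complex.I *
      ((∑ j, (n j : ℂ) ^ 2) * (p / q) + (∑ j, (x j : ℂ) * n j) / q))‖ = 1 := by
    intro n
    have e : (2 * Real.pi * Complex.I *
      ((∑ j, (n j : ℂ) ^ 2) * (p / q) + (∑ j, (x j : ℂ) * n j) / q)) =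
      ((2 * Real.pi * ((∑ j, (n j : ℝ) ^ 2) * (p / q) + (∑ j, (x j : ℝ) * n j) / q) : ℝ) : ℂ) *
        Complex.I := by
      push_cast
      ring
    rw [e, Complex.norm_exp_ofReal_mul_I]
  simp only [h, sum_const, Fintype.card_piFinset, Nat.card_Icc, add_tsub_cancel_right, prod_const,
    card_univ, Fintype.card_fin, nsmul_eq_mul, mul_one, Nat.cast_pow]
  exact le_rfl

/-- The function `G(p/q; ⌊q ξ⌉) g(ξ)` on the torus. -/
noncomputable def gaussTwist (p q : ℕ) (g : UnitAddTorus (Fin d) → ℂ) (ξ : UnitAddTorus (Fin d)) : ℂ :=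
  gaussSum p q (gridPoint q ξ) * g ξ

theorem memLp_gaussTwist (p : ℕ) {q : ℕ} (hq : 0 < q) {g : UnitAddTorus (Fin d) → ℂ}
    (hg : MemLp g 2 (torusMeasure d)) : MemLp (gaussTwist p q g) 2 (torusMeasure d) :=
  memLp_mul_of_bounded ((measurable_of_countable (gaussSum p q)).comp (measurable_gridPoint q))
    (fun _ => norm_gaussSum_le hq _) hg

theorem enorm_gaussTwist_le (p : ℕ) {q : ℕ} (hq : 0 < q) (g : UnitAddTorus (Fin d) → ℂ)
    (ξ : UnitAddTorus (Fin d)) : ‖gaussTwist p q g ξ‖ₑ ≤ ‖g ξ‖ₑ := by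
  rw [enorm_le_iff_norm_le, gaussTwist, norm_mul]
  exact mul_le_of_le_one_left (norm_nonneg _) (norm_gaussSum_le hq _)

/-- Up to a factor of modulus at most `t^{d-2} σ(S^{d-1}) / (2 |S_t ∩ ℤ^d|)`, the operator is the one
whose multiplier is the normalized Fourier transform of a sphere, applied to the twist of `f` by a
Gauss sum. -/
theorem norm_multiplierOp_aMultiplier_le (hd : 2 ≤ d) (p : ℕ) {q : ℕ} (hq : 0 < q) (n : ℕ)
    (f : lp (fun _ : Fin d → ℤ => ℂ) 2) (x : Fin d → ℤ) :
    ‖multiplierOp (aMultiplier (2 ^ n) p q) f x‖ ≤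
      ((2 : ℝ) ^ n) ^ (d - 2) * sphereArea d / (2 * latticeSphereCard d (2 ^ n)) *
        ‖invFourier (fun ξ => ((sphereArea d)⁻¹ : ℂ) *
          sphereFourier ((2 ^ n * (q : ℝ)⁻¹) • gridOffset q ξ) *
            gaussTwist p q (fourierL2 f) ξ) x‖ := by
  have hσ := sphereArea_pos (show 0 < d by omega)
  have hσ' : (sphereArea d : ℂ) ≠ 0 := by exact_mod_cast hσ.ne'
  have hq' : (q : ℝ) ≠ 0 := by exact_mod_cast hq.ne'
  set t : ℝ := 2 ^ n with ht
  have ht0 : 0 < t := by positivity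
  set c : ℝ := (t ^ 2) ^ ((d : ℝ) / 2 - 1) / (2 * (latticeSphereCard d t : ℝ)) with hc
  set e : ℂ := Complex.exp (-(2 * Real.pi * Complex.I * ((t : ℂ) ^ 2 * (p / q)))) with he
  have hen : ‖e‖ = 1 := by
    have : (-(2 * Real.pi * Complex.I * ((t : ℂ) ^ 2 * (p / q))) : ℂ) =
        ((-(2 * Real.pi * (t ^ 2 * (p / q))) : ℝ) : ℂ) * Complex.I := by push_cast; ring
    rw [he, this, Complex.norm_exp_ofReal_mul_I]
  have hc2 : c = t ^ (d - 2) / (2 * latticeSphereCard d t) := by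
    rw [hc, ← Real.rpow_natCast t 2, ← Real.rpow_mul ht0.le, ← Real.rpow_natCast t (d - 2),
      Nat.cast_sub hd]
    congr 2
    push_cast
    ring
  have hpt : ∀ ξ : UnitAddTorus (Fin d), aMultiplier t p q (cubeRep ξ) * fourierL2 f ξ =
      (c * e * sphereArea d) * (((sphereArea d)⁻¹ : ℂ) *
          sphereFourier ((t * (q : ℝ)⁻¹) • gridOffset q ξ) * gaussTwist p q (fourierL2 f) ξ) := by
    intro ξ
    have hη : Real.sqrt (t ^ 2) • ((q : ℝ)⁻¹ • toReal (nearestInt ((q : ℝ) • cubeRep ξ)) -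
        cubeRep ξ) = (t * (q : ℝ)⁻¹) • gridOffset q ξ := by
      rw [Real.sqrt_sq ht0.le, gridOffset, gridPoint, mul_smul]
      congr 1
      rw [smul_sub, smul_smul, inv_mul_cancel₀ hq', one_smul]
    rw [aMultiplier, hη, gaussTwist, gridPoint, ← hc, ← he]
    linear_combination (-(c * e * gaussSum p q (nearestInt ((q : ℝ) • cubeRep ξ)) *
      sphereFourier ((t * (q : ℝ)⁻¹) • gridOffset q ξ) * fourierL2 f ξ)) * mul_inv_cancel₀ hσ'
  have hop : multiplierOp (aMultiplier t p q) f x = (c * e * sphereArea d) *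
      invFourier (fun ξ => ((sphereArea d)⁻¹ : ℂ) *
          sphereFourier ((t * (q : ℝ)⁻¹) • gridOffset q ξ) *
            gaussTwist p q (fourierL2 f) ξ) x := by
    rw [multiplierOp, invFourier, ← integral_const_mul]
    refine integral_congr_ae (Filter.Eventually.of_forall fun ξ => ?_)
    simp only [hpt]
    ring
  rw [hop, norm_mul, norm_mul, norm_mul, hen, Complex.norm_real, Complex.norm_real,
    Real.norm_of_nonneg (by positivity : 0 ≤ c), Real.norm_of_nonneg hσ.le, hc2]
  refine le_of_eq ?_
  ring

/-- The square function of the differences between the spherical multipliers and the multipliers of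
the ergodic averages. -/
theorem lintegral_tsum_multiplierDiff_le (hd : 6 ≤ d) {q : ℕ} (hq : 0 < q)
    {g : UnitAddTorus (Fin d) → ℂ} (hg : MemLp g 2 (torusMeasure d)) :
    ∫⁻ x, ∑' n : ℕ, ‖invFourier (fun ξ => multiplierDiff (2 ^ n * (q : ℝ)⁻¹) (gridOffset q ξ) * g ξ)
        x‖ₑ ^ 2 ∂Measure.count ≤ 3500 * ∫⁻ ξ, ‖g ξ‖ₑ ^ 2 ∂torusMeasure d := by
  have hd0 : 0 < d := by omega
  have hq' : (0 : ℝ) < (q : ℝ)⁻¹ := by positivity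
  have hmeas : ∀ n : ℕ, Measurable fun ξ : UnitAddTorus (Fin d) =>
      multiplierDiff (2 ^ n * (q : ℝ)⁻¹) (gridOffset q ξ) := by
    intro n
    have h1 : Measurable (meanSinSq (d := d)) := by unfold meanSinSq; fun_prop
    have h2 : Measurable fun w : EuclideanSpace ℝ (Fin d) => multiplierDiff (2 ^ n * (q : ℝ)⁻¹) w := by
      unfold multiplierDiff averageMultiplier
      have h3 : Measurable (sphereFourier (d := d)) := continuous_sphereFourier.measurable
      fun_prop
    exact h2.comp (measurable_gridOffset q)
  have hbound : ∀ (n : ℕ) (ξ : UnitAddTorus (Fin d)),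
      ‖multiplierDiff (2 ^ n * (q : ℝ)⁻¹) (gridOffset q ξ)‖ ≤ 2 := by
    intro n ξ
    refine (norm_sub_le _ _).trans ?_
    have h1 := norm_inv_mul_sphereFourier_le hd0 ((2 ^ n * (q : ℝ)⁻¹) • gridOffset q ξ)
    have h2 := abs_averageMultiplier_le_one ⌈(2 ^ n * (q : ℝ)⁻¹) ^ 2⌉₊ (abs_walkMultiplier_le hd0 q ξ)
    rw [Complex.norm_real, Real.norm_eq_abs]
    unfold walkMultiplier at h2
    linarith
  rw [lintegral_tsum fun n => (measurable_of_countable _).aemeasurable]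
  simp only [lintegral_invFourier_sq (memLp_mul_of_bounded (hmeas _) (hbound _) hg)]
  have hsum := lintegral_tsum (μ := torusMeasure d) (f := fun (n : ℕ) ξ =>
    ‖multiplierDiff (2 ^ n * (q : ℝ)⁻¹) (gridOffset q ξ) * g ξ‖ₑ ^ 2) fun n =>
    (((hmeas n).aestronglyMeasurable.mul hg.1).enorm.pow_const 2)
  rw [← hsum, ← lintegral_const_mul' _ _ (by norm_num)]
  refine lintegral_mono fun ξ => ?_
  simp only [enorm_mul, mul_pow]
  rw [ENNReal.tsum_mul_right]
  gcongr
  exact tsum_multiplierDiff_le hd hq' (abs_gridOffset_le q ξ)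

/-- The maximal inequality, given a bound `K` for the normalizing constants of the multipliers. -/
theorem lintegral_maximalFn_sq_le {K : ℝ} (hK : 0 ≤ K) {C : ℝ} (hd : 6 ≤ d) (p : ℕ) {q : ℕ}
    (hq : 0 < q)
    (hcard : ∀ n : ℕ, C * (d : ℝ) ^ (3 / 2 : ℝ) ≤ 2 ^ n →
      ((2 : ℝ) ^ n) ^ (d - 2) * sphereArea d / (2 * latticeSphereCard d (2 ^ n)) ≤ K)
    (f : lp (fun _ : Fin d → ℤ => ℂ) 2) :
    ∫⁻ x, maximalFn C p q f x ^ 2 ∂Measure.count ≤ ENNReal.ofReal ((100 * K * ‖f‖) ^ 2) := by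
  have hd0 : 0 < d := by omega
  have : Nonempty (Fin d × Bool) := ⟨(⟨0, hd0⟩, true)⟩
  set g := gaussTwist p q (fourierL2 f) with hgdef
  have hg : MemLp g 2 (torusMeasure d) := memLp_gaussTwist p hq (memLp_fourierL2 f)
  have hgn : ∫⁻ ξ, ‖g ξ‖ₑ ^ 2 ∂torusMeasure d ≤ ENNReal.ofReal (‖f‖ ^ 2) := by
    rw [← lintegral_fourierL2_sq f]
    exact lintegral_mono fun ξ => pow_le_pow_left' (enorm_gaussTwist_le p hq _ ξ) 2
  let A : (Fin d → ℤ) → ℝ≥0∞ := fun x => ⨆ n : ℕ,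
    ‖(((n + 1 : ℕ) : ℝ))⁻¹ • RandomWalk.walkSum (gridStep q) (invFourier g) (n + 1) x‖ₑ
  let D : (Fin d → ℤ) → ℝ≥0∞ := fun x => ∑' n : ℕ,
    ‖invFourier (fun ξ => multiplierDiff (2 ^ n * (q : ℝ)⁻¹) (gridOffset q ξ) * g ξ) x‖ₑ ^ 2
  -- each operator is an ergodic average plus one of the differences in the square function
  have hpoint : ∀ x, maximalFn C p q f x ^ 2 ≤
      ENNReal.ofReal (2 * K ^ 2) * (A x ^ 2 + D x) := by
    intro x
    rw [maximalFn, ENNReal.iSup₂_pow_of_ne_zero _ two_ne_zero]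
    refine iSup₂_le ?_
    rintro _ ⟨⟨n, rfl⟩, hn⟩
    set s : ℝ := 2 ^ n * (q : ℝ)⁻¹ with hs
    have hs0 : 0 < s := by positivity
    obtain ⟨N, hN⟩ : ∃ N, ⌈s ^ 2⌉₊ = N + 1 :=
      Nat.exists_eq_succ_of_ne_zero (Nat.ceil_pos.2 (by positivity)).ne'
    set a := invFourier (fun ξ => (averageMultiplier ⌈s ^ 2⌉₊ (walkMultiplier q ξ) : ℂ) * g ξ) x
    set b := invFourier (fun ξ => multiplierDiff s (gridOffset q ξ) * g ξ) x
    have hsplit : invFourier (fun ξ => ((sphereArea d)⁻¹ : ℂ) *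
        sphereFourier (s • gridOffset q ξ) * g ξ) x = a + b := by
      have hma : MemLp (fun ξ => (averageMultiplier ⌈s ^ 2⌉₊ (walkMultiplier q ξ) : ℂ) * g ξ) 2
          (torusMeasure d) := by
        refine memLp_mul_of_bounded (C := 1) ?_ (fun ξ => ?_) hg
        · have := measurable_walkMultiplier (d := d) q
          unfold averageMultiplier
          fun_prop
        · rw [Complex.norm_real]
          exact abs_averageMultiplier_le_one _ (abs_walkMultiplier_le hd0 q ξ)
      have hms : MemLp (fun ξ => ((sphereArea d)⁻¹ : ℂ) * sphereFourier (s • gridOffset q ξ) * g ξ) 2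
          (torusMeasure d) := by
        refine memLp_mul_of_bounded (C := 1) ?_ (fun ξ => norm_inv_mul_sphereFourier_le hd0 _) hg
        have h1 := measurable_gridOffset (d := d) q
        have h3 : Measurable (sphereFourier (d := d)) := continuous_sphereFourier.measurable
        fun_prop
      have hb : b = invFourier (fun ξ => ((sphereArea d)⁻¹ : ℂ) *
          sphereFourier (s • gridOffset q ξ) * g ξ) x - a := by
        simp only [a, b, invFourier]
        rw [← integral_sub (integrable_mul_mFourier hms x) (integrable_mul_mFourier hma x)]
        refine integral_congr_ae (Filter.Eventually.of_forall fun ξ => ?_)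
        simp only [multiplierDiff, walkMultiplier]
        ring
      rw [hb]
      ring
    have hop := norm_multiplierOp_aMultiplier_le (show 2 ≤ d by omega) p hq n f x
    rw [← hs, ← hgdef, hsplit] at hop
    have h1 : ‖multiplierOp (aMultiplier (2 ^ n) p q) f x‖ ^ 2 ≤
        2 * K ^ 2 * (‖a‖ ^ 2 + ‖b‖ ^ 2) := by
      have h2 : ‖multiplierOp (aMultiplier (2 ^ n) p q) f x‖ ≤ K * (‖a‖ + ‖b‖) :=
        hop.trans (mul_le_mul (hcard n hn) (norm_add_le _ _) (norm_nonneg _) hK)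
      calc _ ≤ (K * (‖a‖ + ‖b‖)) ^ 2 := by gcongr
        _ = K ^ 2 * (‖a‖ + ‖b‖) ^ 2 := by ring
        _ ≤ K ^ 2 * (2 * (‖a‖ ^ 2 + ‖b‖ ^ 2)) := by gcongr; exact add_sq_le
        _ = _ := by ring
    have h3 : ‖a‖ₑ ≤ A x := by
      have := average_invFourier hd0 q (N + 1) hg x
      rw [← hN] at this
      simp only [a]
      rw [← this, hN]
      exact le_iSup (fun n : ℕ => ‖(((n + 1 : ℕ) : ℝ))⁻¹ •
        RandomWalk.walkSum (gridStep q) (invFourier g) (n + 1) x‖ₑ) N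
    have h4 : ‖b‖ₑ ^ 2 ≤ D x := ENNReal.le_tsum (f := fun n : ℕ =>
      ‖invFourier (fun ξ => multiplierDiff (2 ^ n * (q : ℝ)⁻¹) (gridOffset q ξ) * g ξ) x‖ₑ ^ 2) n
    calc ‖multiplierOp (aMultiplier (2 ^ n) p q) f x‖ₑ ^ 2
        = ENNReal.ofReal (‖multiplierOp (aMultiplier (2 ^ n) p q) f x‖ ^ 2) := by
          rw [← ofReal_norm, ENNReal.ofReal_pow (norm_nonneg _)]
      _ ≤ ENNReal.ofReal (2 * K ^ 2 * (‖a‖ ^ 2 + ‖b‖ ^ 2)) := ENNReal.ofReal_le_ofReal h1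
      _ = ENNReal.ofReal (2 * K ^ 2) * (‖a‖ₑ ^ 2 + ‖b‖ₑ ^ 2) := by
          rw [ENNReal.ofReal_mul (by positivity), ENNReal.ofReal_add (by positivity) (by positivity),
            ENNReal.ofReal_pow (norm_nonneg _), ENNReal.ofReal_pow (norm_nonneg _), ofReal_norm,
            ofReal_norm]
      _ ≤ _ := by gcongr
  have hA : ∫⁻ x, A x ^ 2 ∂Measure.count ≤ 4 * ENNReal.ofReal (‖f‖ ^ 2) := by
    have hsum : Summable fun x => ‖invFourier g x‖ ^ 2 := by
      have h1 := lintegral_invFourier_sq hg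
      have h2 : ∑' x, ‖invFourier g x‖ₑ ^ 2 ≠ ∞ := by
        rw [← lintegral_count, h1]
        exact (hgn.trans_lt ENNReal.ofReal_lt_top).ne
      have h3 := ENNReal.summable_toReal h2
      simpa using h3
    refine (RandomWalk.lintegral_sq_iSup_average_le hsum).trans ?_
    rw [lintegral_invFourier_sq hg]
    gcongr
  have hD : ∫⁻ x, D x ∂Measure.count ≤ 3500 * ENNReal.ofReal (‖f‖ ^ 2) :=
    (lintegral_tsum_multiplierDiff_le hd hq hg).trans (by gcongr)
  calc ∫⁻ x, maximalFn C p q f x ^ 2 ∂Measure.count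
      ≤ ∫⁻ x, ENNReal.ofReal (2 * K ^ 2) * (A x ^ 2 + D x) ∂Measure.count := lintegral_mono hpoint
    _ = ENNReal.ofReal (2 * K ^ 2) *
        (∫⁻ x, A x ^ 2 ∂Measure.count + ∫⁻ x, D x ∂Measure.count) := by
        rw [lintegral_const_mul _ (measurable_of_countable _),
          lintegral_add_left (measurable_of_countable _)]
    _ ≤ ENNReal.ofReal (2 * K ^ 2) *
        (4 * ENNReal.ofReal (‖f‖ ^ 2) + 3500 * ENNReal.ofReal (‖f‖ ^ 2)) := by gcongr
    _ = ENNReal.ofReal (2 * K ^ 2 * (3504 * ‖f‖ ^ 2)) := by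
        rw [ENNReal.ofReal_mul (p := 2 * K ^ 2) (by positivity), ENNReal.ofReal_mul (by norm_num),
          ← add_mul]
        norm_num
    _ ≤ _ := by
        refine ENNReal.ofReal_le_ofReal ?_
        nlinarith [sq_nonneg (K * ‖f‖)]

end SphericalMaximal

theorem theorem5p2 :
    ∃ C : ℝ, 0 < C ∧ ∃ A : ℝ, 0 < A ∧
      ∀ d : ℕ, 16 ≤ d → ∀ p q : ℕ, 1 ≤ p → p ≤ q → Nat.Coprime p q →
        ∀ f : lp (fun _ : Fin d → ℤ => ℂ) 2,
          eLpNorm (SphericalMaximal.maximalFn C p q f) 2 Measure.count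
            ≤ ENNReal.ofReal (A * ‖f‖) := by
  refine ⟨2, two_pos, 100 * (100000 * Real.exp 4), by positivity, fun d hd p q hp hpq _ f => ?_⟩
  have h := SphericalMaximal.lintegral_maximalFn_sq_le (K := 100000 * Real.exp 4) (by positivity)
    (C := 2) (show 6 ≤ d by omega) p (show 0 < q by omega) (fun n hn => by
      have h1 := SphericalMaximal.sphere_area_le_latticeSphereCard hd n hn
      rw [← SphericalMaximal.sphereArea_eq (by omega)] at h1
      exact div_le_of_le_mul₀ (by positivity) (by positivity) (by linarith)) f
  rw [eLpNorm_eq_lintegral_rpow_enorm_toReal two_ne_zero ENNReal.ofNat_ne_top]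
  simp only [enorm_eq_self, ENNReal.toReal_ofNat, ENNReal.rpow_ofNat]
  refine (ENNReal.rpow_le_rpow h (by norm_num)).trans (le_of_eq ?_)
  rw [ENNReal.ofReal_pow (by positivity), ← ENNReal.rpow_natCast, ← ENNReal.rpow_mul]
  norm_num
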